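/- \textbf{Setting.} $[k]=\{0,\dots,k-1\}$. A \emph{search problem} is a family (indexed by size parameters) of relations between inputs and solutions; an input consists of finitely many blocks, each holding a symbol from a finite alphabet, and its length $N$ is the total number of bits of its blocks. A decision tree queries whole blocks; its \emph{block-depth} is the maximal number of queries on a path. $\mathsf{TFNP}^{\mathsf{dt}}$ is the class of search problems in which every input has a solution, blocks and solutions have $\mathrm{polylog}(N)$ bits, and each potential solution can be verified by a decision tree of block-depth $\mathrm{polylog}(N)$. A \emph{reduction of block-depth $d$} from $P$ to $Q$ maps an input $x$ of $P$ to an input $f(x)$ of $Q$ of length at most $2^d$, and each solution $o$ of $f(x)$ to a solution $g(x,o)$ of $x$, where each block of $f(x)$, and $g(x,o)$ for each fixed $o$, is computed by a decision tree of block-depth at most $d$. (Reductions may be non-uniform.) $P$ \emph{reduces} to $Q$ if there are reductions of block-depth $\mathrm{polylog}(N)$, with $N$ the input length of $P$. $\mathsf{Iter}$: given $S:[L]\to[L]$ ($L\ge1$), find $x$ with ($x=0$ and $S(0)=0$), or $S(x)<x$, or ($S(x)>x$ and $S(S(x))=S(x)$). The problem $\mathrm{rwPHP}(\mathsf{PLS})$: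 for $M,L\ge1$ and $N\ge2M$, given $f:[M]\to[N]$ and, for every $y\in[N]$, an $\mathsf{Iter}$ instance $I_y=(S_y:[L]\to[L])$ and a function $g_y:[L]\to[M]$, each function value being one block, find $y\in[N]$ and a solution $ans\in[L]$ of $I_y$ with $f(g_y(ans))\ne y$. The class $\mathrm{rwPHP}(\mathsf{PLS})$ consists of all problems in $\mathsf{TFNP}^{\mathsf{dt}}$ that reduce to this problem. A problem is \emph{complete} for a class if it belongs to the class and every problem of the class reduces to it. $\mathrm{PHP}_{m\to n}$ is the CNF in variables $x_{ij}$ ($i\in[m]$, $j\in[n]$) with clauses $\bigvee_{j}x_{ij}$ for all $i$ and $\overline x_{ij}\vee\overline x_{i'j}$ for all $i<i'$ and $j$. A \emph{purported resolution refutation} of a CNF $F$ of size $L$ is a list of nodes $0,\dots,L-1$, each consisting of a clause (a set of literals) $C_i$ and either two predecessors and a variable $x$ (``resolution'') or one predecessor (``weakening''), where a predecessor is an axiom of $F$ or an earlier node. Node $i$ is valid if, respectively, the predecessor clauses are $x\vee D$ and $\overline x\vee E$ with $C_i=D\vee E$ for some clauses $D,E$, or $C_i=C_j\vee D$ for the predecessor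 clause $C_j$ and some clause $D$; and, if $i=L-1$, moreover $C_i=\bot$. The problem $\textsc{Refuter}(F,L)$: given a purported resolution refutation of $F$ of size $L$ (each node is one block), find an invalid node. Finally, $\textsc{Refuter}(s(\mathrm{PHP}_{(n+1)\to n}\vdash_{\mathsf{Res}}\bot)\le1.01^n)$ is the family $\textsc{Refuter}(\mathrm{PHP}_{(n+1)\to n},\lfloor1.01^n\rfloor)$, $n\ge1$. \textbf{Theorem.} $\textsc{Refuter}(s(\mathrm{PHP}_{(n+1)\to n}\vdash_{\mathsf{Res}}\bot)\le1.01^n)$ is complete for $\mathrm{rwPHP}(\mathsf{PLS})$. Moreover, the reductions have $\mathrm{poly}(n)$ block-depth: there is a constant $c$ such that \begin{itemize} \item for all $n\ge1$ and $1\le L\le1.01^n$ there is a reduction of block-depth $c\,n^c+c$ from $\textsc{Refuter}(\mathrm{PHP}_{(n+1)\to n},L)$ to the problem $\mathrm{rwPHP}(\mathsf{PLS})$ with some parameters; and \item for all parameters of the problem $\mathrm{rwPHP}(\mathsf{PLS})$, with input length $N'$, there are $n\ge1$ with $n\le c\,(\lfloor\log_2N'\rfloor)^c+c$ and a reduction of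 block-depth $c\,n^c+c$ from it to $\textsc{Refuter}(\mathrm{PHP}_{(n+1)\to n},\lfloor1.01^n\rfloor)$. \end{itemize} -/

import Mathlib

/-! ## Decision trees over block-structured inputs -/

/-- A decision tree over inputs `x : ∀ b, A b` that are split into blocks `b : B`. A query reveals
the whole content of one block; a leaf carries the output. -/
inductive DecisionTree (B : Type) (A : B → Type) (R : Type) : Type where
  | leaf (r : R) : DecisionTree B A R
  | query (b : B) (next : A b → DecisionTree B A R) : DecisionTree B A R

namespace DecisionTree

/-- The output of the tree on input `x`. -/
def eval {B : Type} {A : B → Type} {R : Type} : DecisionTree B A R → (∀ b, A b) → R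
  | leaf r, _ => r
  | query b next, x => (next (x b)).eval x

/-- The tree has block-depth at most `d`: at most `d` blocks are queried along every path. -/
def DepthLE {B : Type} {A : B → Type} {R : Type} : DecisionTree B A R → ℕ → Prop
  | leaf _, _ => True
  | query _ _, 0 => False
  | query _ next, d + 1 => ∀ a, (next a).DepthLE d

end DecisionTree

/-! ## Search problems, decision-tree reductions, decision-tree TFNP -/

/-- A search problem on inputs of one fixed shape: finitely many blocks, each holding a symbol of a
finite alphabet, together with a finite solution space and a solution relation. Bit inputs
`{0,1}^N` are the case `Block = Fin N`, `Alphabet _ = Bool`. -/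
structure SearchProblem : Type 1 where
  Block : Type
  Alphabet : Block → Type
  Sol : Type
  [fintypeBlock : Fintype Block]
  [fintypeAlphabet : ∀ b, Fintype (Alphabet b)]
  [fintypeSol : Fintype Sol]
  rel : (∀ b, Alphabet b) → Sol → Prop

attribute [instance] SearchProblem.fintypeBlock SearchProblem.fintypeAlphabet
  SearchProblem.fintypeSol

namespace SearchProblem

/-- The number of bits of block `b`. -/
def blockBits (P : SearchProblem) (b : P.Block) : ℕ := Nat.clog 2 (Fintype.card (P.Alphabet b))

/-- The input length in bits. -/
def size (P : SearchProblem) : ℕ := ∑ b, P.blockBits b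

end SearchProblem

/-- A decision-tree (many-one) reduction of block-depth `d` from `P` to `Q`. Every block of the
`Q`-instance `f x` is computed from the input `x` of `P` by a tree of block-depth at most `d`, and
so is, for every potential solution `o` of the `Q`-instance, the solution `g (x, o)` of `x`.
The input length of `Q` is at most exponential in `d`. -/
structure Reduction (P Q : SearchProblem) (d : ℕ) where
  f : ∀ b : Q.Block, DecisionTree P.Block P.Alphabet (Q.Alphabet b)
  g : Q.Sol → DecisionTree P.Block P.Alphabet P.Sol
  depth_f : ∀ b, (f b).DepthLE d
  depth_g : ∀ o, (g o).DepthLE d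
  size_le : Q.size ≤ 2 ^ d
  correct : ∀ (x : ∀ b, P.Alphabet b) (o : Q.Sol),
    Q.rel (fun b => (f b).eval x) o → P.rel x ((g o).eval x)

/-- A search problem as a family `{P_p}` over a set of size parameters. -/
structure ProblemFamily : Type 1 where
  Param : Type
  prob : Param → SearchProblem

/-- The polylogarithmic bound `c · (log N)^c + c`. -/
def polylog (c N : ℕ) : ℕ := c * Nat.log 2 N ^ c + c

/-- `P` reduces to `Q` by decision-tree reductions of block-depth polylogarithmic in the input
length. -/
def Reduces (P Q : ProblemFamily) : Prop :=
  ∃ c : ℕ, ∀ p : P.Param, ∃ q : Q.Param,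
    Nonempty (Reduction (P.prob p) (Q.prob q) (polylog c (P.prob p).size))

/-- The class of total search problems in the decision-tree model: with `N` the input length,
every block and every solution has `polylog N` bits, solutions can be verified by decision trees of
block-depth `polylog N`, and every input has a solution. -/
def TFNPdt : Set ProblemFamily :=
  { P | (∃ c : ℕ, ∀ p : P.Param,
      (∀ b, (P.prob p).blockBits b ≤ polylog c (P.prob p).size) ∧
      Nat.clog 2 (Fintype.card (P.prob p).Sol) ≤ polylog c (P.prob p).size ∧
      ∀ o : (P.prob p).Sol, ∃ T : DecisionTree (P.prob p).Block (P.prob p).Alphabet Bool,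
        T.DepthLE (polylog c (P.prob p).size) ∧ ∀ x, T.eval x = true ↔ (P.prob p).rel x o) ∧
    ∀ (p : P.Param) (x : ∀ b, (P.prob p).Alphabet b), ∃ o, (P.prob p).rel x o }

/-- `P` is complete for the class `C`. -/
def IsCompleteFor (P : ProblemFamily) (C : Set ProblemFamily) : Prop :=
  P ∈ C ∧ ∀ Q ∈ C, Reduces Q P

/-! ## The class rwPHP(PLS) -/

/-- The PLS-complete problem `Iter` on functions `S : [L] → [L]`. -/
def iterProblem (L : ℕ) : SearchProblem where
  Block := Fin L
  Alphabet := fun _ => Fin L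
  Sol := Fin L
  rel := fun S x =>
    ((x : ℕ) = 0 ∧ S x = x) ∨ S x < x ∨ (x < S x ∧ S (S x) = S x)

/-- Blocks of an `rwPHP(P)` instance: the values of `f : [M] → [N]`, the blocks of the
`P`-instances `I_y`, `y ∈ [N]`, and the labels `g_y(ans)`, `y ∈ [N]`, `ans` a potential solution. -/
abbrev RwBlock (P : SearchProblem) (M N : ℕ) : Type :=
  Fin M ⊕ (Fin N × P.Block) ⊕ (Fin N × P.Sol)

/-- Contents of the blocks of an `rwPHP(P)` instance. -/
abbrev RwAlphabet (P : SearchProblem) (M N : ℕ) : RwBlock P M N → Type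
  | .inl _ => Fin N
  | .inr (.inl (_, b)) => P.Alphabet b
  | .inr (.inr _) => Fin M

instance rwAlphabetFintype (P : SearchProblem) (M N : ℕ) :
    ∀ b : RwBlock P M N, Fintype (RwAlphabet P M N b)
  | .inl _ => inferInstanceAs (Fintype (Fin N))
  | .inr (.inl (_, b)) => inferInstanceAs (Fintype (P.Alphabet b))
  | .inr (.inr _) => inferInstanceAs (Fintype (Fin M))

/-- The problem `rwPHP(P)`: find `y ∈ [N]` and a solution `ans` of `I_y` with
`f (g_y ans) ≠ y`. -/
def rwPHP (P : SearchProblem) (M N : ℕ) : SearchProblem where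
  Block := RwBlock P M N
  Alphabet := RwAlphabet P M N
  Sol := Fin N × P.Sol
  fintypeAlphabet := rwAlphabetFintype P M N
  rel := fun x s =>
    let f : Fin M → Fin N := fun i => x (.inl i)
    let I : Fin N → ∀ b, P.Alphabet b := fun y b => x (.inr (.inl (y, b)))
    let g : Fin N → P.Sol → Fin M := fun y a => x (.inr (.inr (y, a)))
    P.rel (I s.1) s.2 ∧ f (g s.1 s.2) ≠ s.1

/-- Parameters of `rwPHP(PLS)` instances: `f : [M] → [N]` with `1 ≤ M ≤ N / 2`, and
`Iter` instances `S_y : [L] → [L]` with `1 ≤ L`. -/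
structure RwParam where
  M : ℕ
  N : ℕ
  L : ℕ
  one_le_M : 1 ≤ M
  two_mul_le : 2 * M ≤ N
  one_le_L : 1 ≤ L

/-- The search problem `rwPHP(PLS)`. -/
def rwPHPIter : ProblemFamily where
  Param := RwParam
  prob := fun q => rwPHP (iterProblem q.L) q.M q.N

/-- The class `rwPHP(PLS)`. -/
def rwPHPPLS : Set ProblemFamily := { P | P ∈ TFNPdt ∧ Reduces P rwPHPIter }

/-! ## Resolution and its refuter problems -/

/-- Literals: `(a, true)` is `x_a` and `(a, false)` is its negation. -/
abbrev Literal (V : Type) : Type := V × Bool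

/-- A clause is a finite set of literals. -/
abbrev Clause (V : Type) : Type := Finset (Literal V)

/-- A CNF is a finite set of clauses. -/
abbrev CNF (V : Type) : Type := Finset (Clause V)

/-- Potential predecessors of the `i`-th node of a refutation of `F`: an axiom of `F`, or an
earlier node. -/
abbrev Pred {V : Type} (F : CNF V) (i : ℕ) : Type := {C : Clause V // C ∈ F} ⊕ Fin i

/-- The information in the `i`-th node of a purported refutation of `F`: a clause, and either
(tag "resolution") two predecessors and the resolved variable or (tag "weakening") one
predecessor. -/
abbrev ResNode {V : Type} (F : CNF V) (i : ℕ) : Type :=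
  Clause V × ((Pred F i × Pred F i × V) ⊕ Pred F i)

/-- The clause of a predecessor of node `i` in the purported refutation `x` of length `L`. -/
def predClause {V : Type} {F : CNF V} {L : ℕ} (x : ∀ i : Fin L, ResNode F i) (i : Fin L) :
    Pred F i → Clause V
  | .inl C => C.1
  | .inr j => (x ⟨j, j.2.trans i.2⟩).1

/-- Node `i` of the purported refutation `x` is derived correctly, and if it is the last node then
its clause is empty. -/
def ValidNode {V : Type} [DecidableEq V] {F : CNF V} {L : ℕ} (x : ∀ i : Fin L, ResNode F i)
    (i : Fin L) : Prop :=
  (match (x i).2 with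
    | .inl (j, k, a) => ∃ D E : Clause V, predClause x i j = insert (a, true) D ∧
        predClause x i k = insert (a, false) E ∧ (x i).1 = D ∪ E
    | .inr j => ∃ D : Clause V, (x i).1 = predClause x i j ∪ D) ∧
  ((i : ℕ) + 1 = L → (x i).1 = ∅)

/-- The refuter problem: given a purported resolution refutation of `F` with `L` nodes, each node
being one block, find a node that is not valid. -/
def refuter {V : Type} [Fintype V] [DecidableEq V] (F : CNF V) (L : ℕ) : SearchProblem where
  Block := Fin L
  Alphabet := fun i => ResNode F i
  Sol := Fin L
  rel := fun x i => ¬ ValidNode x i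

/-- The pigeonhole principle with `m` pigeons and `n` holes; `x_{ij}` says that pigeon `i` goes to
hole `j`. -/
def PHP (m n : ℕ) : CNF (Fin m × Fin n) :=
  (Finset.univ.image fun i : Fin m => Finset.univ.image fun j : Fin n => ((i, j), true)) ∪
  ((Finset.univ.filter fun t : Fin m × Fin m × Fin n => t.1 < t.2.1).image fun t =>
    {((t.1, t.2.2), false), ((t.2.1, t.2.2), false)})

/-- The refuter problem for Haken's lower bound: given a purported resolution refutation of
`PHP_{(n+1) → n}` with `⌊1.01^n⌋` nodes, find an invalid node (`n ≥ 1`). -/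
noncomputable def hakenRefuter : ProblemFamily where
  Param := ℕ+
  prob := fun n => refuter (PHP ((n : ℕ) + 1) n) ⌊(1.01 : ℝ) ^ (n : ℕ)⌋₊

/-! ## Functions computed by shallow decision trees -/

namespace DecisionTree

variable {B : Type} {A : B → Type} {R R' : Type}

/-! Membership is a search version of Haken's lower bound. Take a word v of k = ⌊(n+1)/4⌋ edges and
its greedy matching σ_v. Weigh a clause C by the number of pigeons left out by critical assignments
that extend σ_v and falsify C. This weight is antitone, subadditive under resolution and at most 1
on axioms, while the empty clause has weight m ≥ 3(n+1)/4. Hence walking back from the empty clause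
through premises of weight above m/3 must, if all nodes met are valid, stop at a clause of weight in
(m/3, 2m/3]. This walk is the `Iter` instance of v.

Swapping left-out pigeons shows that at least one eighth of all edges lie in the monotone version of
such a clause and avoid σ_v (`card_mul_le_card_liveEdges`), and σ_v itself contains none of its
edges. For a fixed clause only a (7/8)^k fraction of the words behave so (`card_misses_le`). So v is
determined by the node reached and one of N/(2L) codes, where N is the number of words. Decoding is
the function f, from at most N/2 codes to words, and a failure to decode v at the end of its walk
exposes an invalid node (`exists_reduction_refuter_php`).

Hardness needs only that every clause mentioning all variables contains an axiom. In the full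
decision tree for the falsified-clause problem, collapse each layer to M nodes, and read f(u) = (v,
b) as "u is the b-child of v"; the clause of u is found by following f back to the root. The forward
edge from y = (v, b) is supplied by I_y and g_y, written out as a chain of weakenings, which goes
wrong only at a solution of I_y with f(g_y) ≠ y (`exists_reduction_to_refuter`). The length is
poly(n)·M·L, which is below 1.01^n already for n logarithmic in the input length; conversely n is
logarithmic in the length of the refuter input, so poly(n) depth is polylogarithmic. -/

theorem DepthLE.mono {T : DecisionTree B A R} {d e : ℕ} (h : T.DepthLE d) (hde : d ≤ e) :
    T.DepthLE e := by
  induction T generalizing d e with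
  | leaf r => exact trivial
  | query b next ih =>
    cases d with
    | zero => exact h.elim
    | succ d =>
      cases e with
      | zero => omega
      | succ e => exact fun a => ih a (h a) (by omega)

/-- Run `T`, then continue with the tree selected by its output. -/
def bind (T : DecisionTree B A R) (G : R → DecisionTree B A R') : DecisionTree B A R' :=
  match T with
  | leaf r => G r
  | query b next => query b fun a => (next a).bind G

theorem eval_bind (T : DecisionTree B A R) (G : R → DecisionTree B A R') (x : ∀ b, A b) :
    (T.bind G).eval x = (G (T.eval x)).eval x := by
  induction T with
  | leaf r => rfl
  | query b next ih => exact ih (x b)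

theorem DepthLE.bind {T : DecisionTree B A R} {G : R → DecisionTree B A R'} {d e : ℕ}
    (hT : T.DepthLE d) (hG : ∀ r, (G r).DepthLE e) : (T.bind G).DepthLE (d + e) := by
  induction T generalizing d with
  | leaf r => exact (hG r).mono (by omega)
  | query b next ih =>
    cases d with
    | zero => exact hT.elim
    | succ d =>
      rw [show d + 1 + e = d + e + 1 by omega]
      exact fun a => ih a (hT a)

/-- `F` is computed by a decision tree of block-depth `d`. -/
def Computes (d : ℕ) (F : (∀ b, A b) → R) : Prop :=
  ∃ T : DecisionTree B A R, T.DepthLE d ∧ ∀ x, T.eval x = F x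

namespace Computes

variable {d e : ℕ} {F : (∀ b, A b) → R}

theorem mono (h : Computes d F) (hde : d ≤ e) : Computes e F :=
  let ⟨T, hT, hF⟩ := h
  ⟨T, hT.mono hde, hF⟩

theorem const (r : R) : Computes (A := A) d fun _ => r := ⟨leaf r, trivial, fun _ => rfl⟩

theorem query (b : B) : Computes 1 fun x : ∀ b, A b => x b :=
  ⟨.query b leaf, fun _ => trivial, fun _ => rfl⟩

theorem bind (hF : Computes d F) {G : R → (∀ b, A b) → R'} (hG : ∀ r, Computes e (G r)) :
    Computes (d + e) fun x => G (F x) x := by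
  obtain ⟨T, hT, hF⟩ := hF
  choose U hU hG using hG
  exact ⟨T.bind U, hT.bind hU, fun x => by rw [eval_bind, hF, hG]⟩

theorem map (hF : Computes d F) (φ : R → R') : Computes d fun x => φ (F x) :=
  hF.bind (e := 0) fun r => const (φ r)

theorem map₂ {R'' : Type} (hF : Computes d F) {G : (∀ b, A b) → R'} (hG : Computes e G)
    (φ : R → R' → R'') : Computes (d + e) fun x => φ (F x) (G x) :=
  hF.bind fun r => hG.map (φ r)

/-- Answer the queries of a tree by trees over another input. -/
theorem subst {B' : Type} {A' : B' → Type} {f : (∀ b, A b) → ∀ b, A' b}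
    (hf : ∀ b, Computes d fun x => f x b) {G : (∀ b, A' b) → R} (hG : Computes e G) :
    Computes (e * d) fun x => G (f x) := by
  obtain ⟨T, hT, hG⟩ := hG
  suffices Computes (e * d) fun x => T.eval (f x) by simpa only [hG] using this
  clear hG
  induction T generalizing e with
  | leaf r => exact const r
  | query b next ih =>
    cases e with
    | zero => exact hT.elim
    | succ e =>
      rw [show (e + 1) * d = d + e * d by ring]
      exact (hf b).bind fun a => ih a (hT a)

end Computes

end DecisionTree

open DecisionTree in
theorem Reduction.nonempty_of_computes {P Q : SearchProblem} {d : ℕ}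
    (f : (∀ b, P.Alphabet b) → ∀ b, Q.Alphabet b) (g : Q.Sol → (∀ b, P.Alphabet b) → P.Sol)
    (hf : ∀ b, Computes d fun x => f x b) (hg : ∀ o, Computes d (g o))
    (size_le : Q.size ≤ 2 ^ d) (correct : ∀ x o, Q.rel (f x) o → P.rel x (g o x)) :
    Nonempty (Reduction P Q d) := by
  choose T hT hf using hf
  choose U hU hg using hg
  refine ⟨⟨T, U, hT, hU, size_le, fun x o h => ?_⟩⟩
  rw [hg]
  exact correct x o (by simpa only [hf] using h)

theorem Reduction.nonempty_mono {P Q : SearchProblem} {d e : ℕ} (h : Nonempty (Reduction P Q d))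
    (hde : d ≤ e) : Nonempty (Reduction P Q e) := by
  obtain ⟨r⟩ := h
  exact ⟨⟨r.f, r.g, fun b => (r.depth_f b).mono hde, fun o => (r.depth_g o).mono hde,
    r.size_le.trans (Nat.pow_le_pow_right (by norm_num) hde), r.correct⟩⟩

-- Simulating a tree of the second reduction costs `e * d` queries, and translating its answer back
-- costs `d` more. The last summand `e` only serves the size bound.
open DecisionTree in
theorem Reduction.nonempty_comp {P Q R : SearchProblem} {d e : ℕ}
    (h : Nonempty (Reduction P Q d)) (h' : Nonempty (Reduction Q R e)) :
    Nonempty (Reduction P R (e * d + d + e)) := by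
  obtain ⟨r⟩ := h
  obtain ⟨s⟩ := h'
  have hr : ∀ b, Computes d fun x => (r.f b).eval x := fun b => ⟨r.f b, r.depth_f b, fun _ => rfl⟩
  refine nonempty_of_computes (fun x b => (s.f b).eval fun b => (r.f b).eval x)
    (fun o x => (r.g ((s.g o).eval fun b => (r.f b).eval x)).eval x) (fun b => ?_) (fun o => ?_)
    (s.size_le.trans (Nat.pow_le_pow_right (by norm_num) (by omega)))
    fun x o h => r.correct _ _ (s.correct _ _ h)
  · exact (Computes.subst hr ⟨s.f b, s.depth_f b, fun _ => rfl⟩).mono (by omega)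
  · have h1 : Computes (e * d) fun x => (s.g o).eval fun b => (r.f b).eval x :=
      Computes.subst hr ⟨s.g o, s.depth_g o, fun _ => rfl⟩
    exact (h1.bind (G := fun o x => (r.g o).eval x)
      fun o => ⟨r.g o, r.depth_g o, fun _ => rfl⟩).mono (by omega)

theorem Reduction.total {P Q : SearchProblem} {d : ℕ} (h : Nonempty (Reduction P Q d))
    (hQ : ∀ x, ∃ o, Q.rel x o) (x : ∀ b, P.Alphabet b) : ∃ o, P.rel x o := by
  obtain ⟨r⟩ := h
  obtain ⟨o, ho⟩ := hQ fun b => (r.f b).eval x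
  exact ⟨_, r.correct x o ho⟩

/-! ## Polynomially bounded functions -/

/-- `h` is bounded by a polynomial. -/
def PolyBounded (h : ℕ → ℕ) : Prop := ∃ c, ∀ x, h x ≤ (x + 2) ^ c

namespace PolyBounded

variable {g h : ℕ → ℕ}

theorem const (k : ℕ) : PolyBounded fun _ => k :=
  ⟨k, fun x => Nat.lt_two_pow_self.le.trans (Nat.pow_le_pow_left (by omega) k)⟩

theorem id : PolyBounded fun x => x := ⟨1, fun x => by simp⟩

theorem add (hg : PolyBounded g) (hh : PolyBounded h) : PolyBounded fun x => g x + h x := by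
  obtain ⟨a, ha⟩ := hg
  obtain ⟨b, hb⟩ := hh
  refine ⟨a + b + 1, fun x => ?_⟩
  have h1 : (x + 2) ^ a ≤ (x + 2) ^ (a + b) := Nat.pow_le_pow_right (by omega) (by omega)
  have h2 : (x + 2) ^ b ≤ (x + 2) ^ (a + b) := Nat.pow_le_pow_right (by omega) (by omega)
  rw [pow_succ]
  nlinarith [ha x, hb x]

theorem mul (hg : PolyBounded g) (hh : PolyBounded h) : PolyBounded fun x => g x * h x := by
  obtain ⟨a, ha⟩ := hg
  obtain ⟨b, hb⟩ := hh
  exact ⟨a + b, fun x => by rw [pow_add]; exact Nat.mul_le_mul (ha x) (hb x)⟩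

theorem pow (hg : PolyBounded g) (k : ℕ) : PolyBounded fun x => g x ^ k := by
  obtain ⟨a, ha⟩ := hg
  exact ⟨a * k, fun x => by rw [pow_mul]; exact Nat.pow_le_pow_left (ha x) k⟩

theorem exists_le (hg : PolyBounded g) : ∃ c, ∀ x, g x ≤ c * x ^ c + c := by
  obtain ⟨a, ha⟩ := hg
  -- The factor `3 ^ a` comes from x + 2 ≤ 3x for x ≥ 1; adding `a` makes the exponent large enough.
  refine ⟨3 ^ a + a, fun x => (ha x).trans ?_⟩
  rcases Nat.eq_zero_or_pos x with rfl | hx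
  · have : (0 + 2) ^ a ≤ 3 ^ a := Nat.pow_le_pow_left (by norm_num) a
    omega
  · calc (x + 2) ^ a ≤ (3 * x) ^ a := Nat.pow_le_pow_left (by omega) a
      _ = 3 ^ a * x ^ a := mul_pow ..
      _ ≤ (3 ^ a + a) * x ^ (3 ^ a + a) :=
        Nat.mul_le_mul (Nat.le_add_right ..) (Nat.pow_le_pow_right hx (Nat.le_add_left ..))
      _ ≤ _ := Nat.le_add_right ..

theorem polylog (c : ℕ) : PolyBounded fun x => c * x ^ c + c :=
  ((const c).mul (id.pow c)).add (const c)

end PolyBounded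

/-! ## Random matchings -/

section Matchings

variable {I J : Type} [DecidableEq I] [DecidableEq J]

/-- Two edges of the complete bipartite graph have no endpoint in common. -/
def EdgesDisjoint (e e' : I × J) : Prop := e.1 ≠ e'.1 ∧ e.2 ≠ e'.2

instance (e e' : I × J) : Decidable (EdgesDisjoint e e') := inferInstanceAs (Decidable (_ ∧ _))

/-- Add `e` to `σ` if it meets no edge of `σ`. -/
def extendMatching (σ : Finset (I × J)) (e : I × J) : Finset (I × J) :=
  if ∀ e' ∈ σ, EdgesDisjoint e' e then insert e σ else σ

/-- The greedy matching obtained by running through a sequence of edges, starting from `σ`. -/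
def greedyMatching : (k : ℕ) → Finset (I × J) → (Fin k → I × J) → Finset (I × J)
  | 0, σ, _ => σ
  | k + 1, σ, v => greedyMatching k (extendMatching σ (v 0)) (Fin.tail v)

/-- The edges of `T` that meet no edge of `σ`. -/
def liveEdges (T σ : Finset (I × J)) : Finset (I × J) :=
  T.filter fun e => ∀ e' ∈ σ, EdgesDisjoint e' e

/-- No edge of `T` is in `σ`, but at least one eighth of all edges are in `T` and avoid `σ`. -/
def Misses [Fintype I] [Fintype J] (T σ : Finset (I × J)) : Prop :=
  (∀ e ∈ σ, e ∉ T) ∧ Fintype.card (I × J) ≤ 8 * (liveEdges T σ).card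

theorem mem_liveEdges {T σ : Finset (I × J)} {e : I × J} :
    e ∈ liveEdges T σ ↔ e ∈ T ∧ ∀ e' ∈ σ, EdgesDisjoint e' e :=
  Finset.mem_filter

theorem subset_extendMatching (σ : Finset (I × J)) (e : I × J) : σ ⊆ extendMatching σ e := by
  unfold extendMatching
  split
  · exact Finset.subset_insert ..
  · exact Finset.Subset.refl _

theorem subset_greedyMatching (k : ℕ) (σ : Finset (I × J)) (v : Fin k → I × J) :
    σ ⊆ greedyMatching k σ v := by
  induction k generalizing σ with
  | zero => exact Finset.Subset.refl _
  | succ k ih => exact (subset_extendMatching σ _).trans (ih ..)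

theorem liveEdges_anti (T : Finset (I × J)) {σ τ : Finset (I × J)} (h : σ ⊆ τ) :
    liveEdges T τ ⊆ liveEdges T σ := by
  intro e he
  rw [mem_liveEdges] at he ⊢
  exact ⟨he.1, fun e' he' => he.2 e' (h he')⟩

theorem card_greedyMatching_le (k : ℕ) (σ : Finset (I × J)) (v : Fin k → I × J) :
    (greedyMatching k σ v).card ≤ σ.card + k := by
  induction k generalizing σ with
  | zero => exact le_rfl
  | succ k ih =>
    refine (ih _ _).trans ?_
    have : (extendMatching σ (v 0)).card ≤ σ.card + 1 := by
      unfold extendMatching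
      split
      · exact Finset.card_insert_le ..
      · omega
    omega

theorem greedyMatching_pairwise (k : ℕ) (σ : Finset (I × J)) (v : Fin k → I × J)
    (hσ : ∀ e ∈ σ, ∀ e' ∈ σ, e ≠ e' → EdgesDisjoint e e') :
    ∀ e ∈ greedyMatching k σ v, ∀ e' ∈ greedyMatching k σ v, e ≠ e' → EdgesDisjoint e e' := by
  induction k generalizing σ with
  | zero => exact hσ
  | succ k ih =>
    refine ih _ _ ?_
    unfold extendMatching
    split
    · next h =>
      intro e he e' he' hne
      rw [Finset.mem_insert] at he he'
      rcases he with rfl | he <;> rcases he' with rfl | he'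
      · exact (hne rfl).elim
      · exact ⟨(h e' he').1.symm, (h e' he').2.symm⟩
      · exact h e he
      · exact hσ e he e' he' hne
    · exact hσ

-- While an eighth of all edges are live in `T`, a random next edge is one of them with probability
-- at least 1/8, and then the matching hits `T` for good. Once fewer are live the event is
-- impossible, as live edges only disappear. So every step costs a factor 7/8.
open Classical in
theorem card_misses_le [Fintype I] [Fintype J] (T : Finset (I × J)) (k : ℕ) (σ : Finset (I × J)) :
    8 ^ k * (Finset.univ.filter fun v => Misses T (greedyMatching k σ v)).card ≤
      (7 * Fintype.card (I × J)) ^ k := by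
  induction k generalizing σ with
  | zero =>
    rw [pow_zero, pow_zero, one_mul]
    exact (Finset.card_le_univ _).trans (by simp)
  | succ k ih =>
    set A := Fintype.card (I × J) with hA
    have hsum : (Finset.univ.filter fun v => Misses T (greedyMatching (k + 1) σ v)).card =
        ∑ e, (Finset.univ.filter fun v =>
          Misses T (greedyMatching k (extendMatching σ e) v)).card := by
      simp only [Finset.card_filter]
      rw [← (Fin.consEquiv fun _ => I × J).sum_comp, Fintype.sum_prod_type]
      rfl
    by_cases hlive : A ≤ 8 * (liveEdges T σ).card
    · have hzero : ∀ e ∈ liveEdges T σ, (Finset.univ.filter fun v =>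
          Misses T (greedyMatching k (extendMatching σ e) v)).card = 0 := by
        intro e he
        rw [Finset.card_eq_zero, Finset.filter_eq_empty_iff]
        intro v _ hv
        rw [mem_liveEdges] at he
        refine hv.1 e (subset_greedyMatching _ _ _ ?_) he.1
        rw [extendMatching, if_pos he.2]
        exact Finset.mem_insert_self ..
      rw [hsum, ← Finset.sum_compl_add_sum (liveEdges T σ), Finset.sum_eq_zero hzero, add_zero,
        Finset.mul_sum]
      calc ∑ e ∈ (liveEdges T σ)ᶜ, 8 ^ (k + 1) * _
          ≤ ∑ e ∈ (liveEdges T σ)ᶜ, 8 * (7 * A) ^ k := by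
            refine Finset.sum_le_sum fun e _ => ?_
            have := ih (extendMatching σ e)
            rw [pow_succ, mul_comm (8 ^ k), mul_assoc]
            exact Nat.mul_le_mul_left _ this
        _ = (8 * (liveEdges T σ)ᶜ.card) * (7 * A) ^ k := by
            rw [Finset.sum_const, smul_eq_mul]; ring
        _ ≤ 7 * A * (7 * A) ^ k := by
            refine Nat.mul_le_mul_right _ ?_
            rw [Finset.card_compl]
            omega
        _ = _ := (pow_succ' ..).symm
    · rw [hsum, Finset.sum_eq_zero, mul_zero]
      · exact Nat.zero_le _
      · intro e _
        rw [Finset.card_eq_zero, Finset.filter_eq_empty_iff]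
        intro v _ hv
        have := Finset.card_le_card (liveEdges_anti T
          ((subset_extendMatching σ e).trans (subset_greedyMatching k _ v)))
        have := hv.2
        omega

end Matchings

/-! ## Critical assignments -/

section Critical

variable {n : ℕ}

/-- The pigeons left out by a critical assignment that extends `σ` and falsifies `C`. A critical
assignment is a bijection of `n + 1` pigeons with `n` holes and the extra value `none`. -/
noncomputable def missingPigeons (σ : Finset (Fin (n + 1) × Fin n))
    (C : Clause (Fin (n + 1) × Fin n)) : Finset (Fin (n + 1)) :=
  open Classical in Finset.univ.filter fun p => ∃ β : Fin (n + 1) ≃ Option (Fin n),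
    (∀ e ∈ σ, β e.1 = some e.2) ∧ β p = none ∧ ∀ l ∈ C, β l.1.1 = some l.1.2 ↔ l.2 = false

theorem mem_missingPigeons {σ : Finset (Fin (n + 1) × Fin n)}
    {C : Clause (Fin (n + 1) × Fin n)} {p : Fin (n + 1)} :
    p ∈ missingPigeons σ C ↔ ∃ β : Fin (n + 1) ≃ Option (Fin n),
      (∀ e ∈ σ, β e.1 = some e.2) ∧ β p = none ∧
        ∀ l ∈ C, β l.1.1 = some l.1.2 ↔ l.2 = false := by
  simp [missingPigeons]

/-- The edges `(p, h)` such that `C` contains `x_{ph}`, or `¬ x_{qh}` for some `q ≠ p`. -/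
def monotoneEdges (C : Clause (Fin (n + 1) × Fin n)) : Finset (Fin (n + 1) × Fin n) :=
  Finset.univ.filter fun e => (e, true) ∈ C ∨ ∃ q, q ≠ e.1 ∧ ((q, e.2), false) ∈ C

variable {σ : Finset (Fin (n + 1) × Fin n)} {C C₁ C₂ : Clause (Fin (n + 1) × Fin n)}

theorem missingPigeons_anti (h : C₁ ⊆ C) : missingPigeons σ C ⊆ missingPigeons σ C₁ := by
  intro p hp
  obtain ⟨β, h1, h2, h3⟩ := mem_missingPigeons.1 hp
  exact mem_missingPigeons.2 ⟨β, h1, h2, fun l hl => h3 l (h hl)⟩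

/-- The same critical assignment falsifies one of the two premises, according to its value at the
resolved variable. -/
theorem missingPigeons_resolve {a : Fin (n + 1) × Fin n} :
    missingPigeons σ (C₁ ∪ C₂) ⊆
      missingPigeons σ (insert (a, true) C₁) ∪ missingPigeons σ (insert (a, false) C₂) := by
  intro p hp
  obtain ⟨β, h1, h2, h3⟩ := mem_missingPigeons.1 hp
  rw [Finset.mem_union, mem_missingPigeons, mem_missingPigeons]
  by_cases ha : β a.1 = some a.2
  · refine Or.inr ⟨β, h1, h2, fun l hl => ?_⟩
    rcases Finset.mem_insert.1 hl with rfl | hl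
    · simp [ha]
    · exact h3 l (Finset.mem_union_right _ hl)
  · refine Or.inl ⟨β, h1, h2, fun l hl => ?_⟩
    rcases Finset.mem_insert.1 hl with rfl | hl
    · simp [ha]
    · exact h3 l (Finset.mem_union_left _ hl)

/-- Only pigeon i can be left out when the clause of pigeon i is falsified; a hole clause is never
falsified by a bijection. -/
theorem card_missingPigeons_axiom (hC : C ∈ PHP (n + 1) n) : (missingPigeons σ C).card ≤ 1 := by
  simp only [PHP, Finset.mem_union, Finset.mem_image, Finset.mem_filter, Finset.mem_univ,
    true_and] at hC
  rcases hC with ⟨i, rfl⟩ | ⟨⟨i, i', j⟩, hlt, rfl⟩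
  · refine Finset.card_le_one_iff_subset_singleton.2 ⟨i, fun p hp => ?_⟩
    obtain ⟨β, -, h2, h3⟩ := mem_missingPigeons.1 hp
    rw [Finset.mem_singleton]
    apply β.injective
    rw [h2]
    cases h : β i with
    | none => rfl
    | some j => simpa [h] using h3 ((i, j), true) (Finset.mem_image_of_mem _ (Finset.mem_univ j))
  · rw [Finset.card_eq_zero.2]
    · norm_num
    · refine Finset.eq_empty_of_forall_notMem fun p hp => ?_
      obtain ⟨β, -, -, h3⟩ := mem_missingPigeons.1 hp
      have h := (h3 ((i, j), false) (by simp)).2 rfl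
      have h' := (h3 ((i', j), false) (by simp)).2 rfl
      exact hlt.ne (β.injective (h.trans h'.symm))

theorem missingPigeons_eq_empty {e : Fin (n + 1) × Fin n} (he : e ∈ σ)
    (heC : e ∈ monotoneEdges C) : missingPigeons σ C = ∅ := by
  refine Finset.eq_empty_of_forall_notMem fun p hp => ?_
  obtain ⟨β, h1, -, h3⟩ := mem_missingPigeons.1 hp
  simp only [monotoneEdges, Finset.mem_filter, Finset.mem_univ, true_and] at heC
  rcases heC with h | ⟨q, hq, h⟩
  · exact absurd ((h3 _ h).1 (h1 e he)) (by simp)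
  · exact hq (β.injective (((h3 _ h).2 rfl).trans (h1 e he).symm))

/-- For every pigeon unmatched by `σ`, the partial injection given by `σ` and sending that pigeon to
`none` extends to a bijection. -/
theorem le_card_missingPigeons_empty
    (hσ : ∀ e ∈ σ, ∀ e' ∈ σ, e ≠ e' → EdgesDisjoint e e') :
    n + 1 ≤ (missingPigeons σ ∅).card + σ.card := by
  classical
  have hsub : (σ.image Prod.fst)ᶜ ⊆ missingPigeons σ ∅ := by
    intro p hp
    rw [Finset.mem_compl, Finset.mem_image] at hp
    let f : Fin (n + 1) → Option (Fin n) := fun i =>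
      if h : ∃ j, (i, j) ∈ σ then some h.choose else none
    have hf : ∀ e ∈ σ, f e.1 = some e.2 := by
      intro e he
      have h : ∃ j, (e.1, j) ∈ σ := ⟨e.2, he⟩
      simp only [f, dif_pos h, Option.some_inj]
      by_contra hne
      exact (hσ _ h.choose_spec e he fun h' => hne (congrArg Prod.snd h')).1 rfl
    have hp' : f p = none := dif_neg fun ⟨j, hj⟩ => hp ⟨(p, j), hj, rfl⟩
    obtain ⟨g, hg⟩ := Finset.exists_equiv_extend_of_card_eq (t := Finset.univ)
      (s := insert p (σ.image Prod.fst)) (f := f) (by simp) (Finset.subset_univ _) (by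
        intro a ha b hb hab
        simp only [Finset.coe_insert, Finset.coe_image, Set.mem_insert_iff, Set.mem_image,
          Finset.mem_coe] at ha hb
        rcases ha with rfl | ⟨e, he, rfl⟩ <;> rcases hb with rfl | ⟨e', he', rfl⟩
        · rfl
        · simp [hp', hf e' he'] at hab
        · simp [hp', hf e he] at hab
        · rw [hf e he, hf e' he', Option.some_inj] at hab
          by_contra hne
          exact (hσ e he e' he' fun h => hne (congrArg Prod.fst h)).2 hab)
    refine mem_missingPigeons.2 ⟨g.trans (Equiv.subtypeUnivEquiv Finset.mem_univ), fun e he => ?_,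
      ?_, by simp⟩
    · exact (hg _ (Finset.mem_insert_of_mem (Finset.mem_image_of_mem _ he))).trans (hf e he)
    · exact (hg _ (Finset.mem_insert_self ..)).trans hp'
  have h1 := Finset.card_le_card hsub
  rw [Finset.card_compl, Fintype.card_fin] at h1
  have h2 : (σ.image Prod.fst).card ≤ σ.card := Finset.card_image_le
  omega

/-- Let `β` leave out p and falsify `C`, and let q be a pigeon that can be left out, but not while
falsifying `C`. Exchanging p and q in `β` must satisfy `C`, which happens only through x_{ph} or
¬x_{qh} with h = β q. Either way (p, h) is a monotone edge, and it is live since `σ` touches neither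
p nor h. -/
theorem card_mul_le_card_liveEdges : (missingPigeons σ C).card *
    ((missingPigeons σ ∅).card - (missingPigeons σ C).card) ≤
      (liveEdges (monotoneEdges C) σ).card := by
  classical
  have hsub : missingPigeons σ C ⊆ missingPigeons σ ∅ :=
    missingPigeons_anti (Finset.empty_subset C)
  rw [← Finset.card_sdiff_of_subset hsub, ← Finset.card_product]
  -- One `β` per p serves all q; this is what allows q to be recovered from the edge (p, h) as
  -- β⁻¹(h).
  have key : ∀ p ∈ missingPigeons σ C, ∃ β : Fin (n + 1) ≃ Option (Fin n),
      ∀ q ∈ missingPigeons σ ∅ \ missingPigeons σ C, ∃ h, β q = some h ∧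
        (p, h) ∈ liveEdges (monotoneEdges C) σ := by
    intro p hp
    obtain ⟨β, h1, h2, h3⟩ := mem_missingPigeons.1 hp
    refine ⟨β, fun q hq => ?_⟩
    rw [Finset.mem_sdiff] at hq
    obtain ⟨hq, hqC⟩ := hq
    obtain ⟨γ, g1, g2, -⟩ := mem_missingPigeons.1 hq
    have hqp : q ≠ p := fun h => hqC (h ▸ hp)
    have hσp : ∀ e ∈ σ, e.1 ≠ p := fun e he h => by simpa [h, h2] using h1 e he
    have hσq : ∀ e ∈ σ, e.1 ≠ q := fun e he h => by simpa [h, g2] using g1 e he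
    obtain ⟨h, hh⟩ : ∃ h, β q = some h :=
      Option.ne_none_iff_exists'.1 fun h => hqp (β.injective (h.trans h2.symm))
    refine ⟨h, hh, ?_⟩
    refine mem_liveEdges.2 ⟨?_, fun e he => ⟨hσp e he, fun heh => hσq e he (β.injective ?_)⟩⟩
    swap
    · rw [h1 e he, hh]
      exact congrArg some heh
    simp only [monotoneEdges, Finset.mem_filter, Finset.mem_univ, true_and]
    by_contra hno
    rw [not_or] at hno
    refine hqC (mem_missingPigeons.2 ⟨(Equiv.swap p q).trans β, fun e he => ?_, ?_, ?_⟩)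
    · rw [Equiv.trans_apply, Equiv.swap_apply_of_ne_of_ne (hσp e he) (hσq e he), h1 e he]
    · simp [h2]
    · rintro ⟨⟨i, j⟩, b⟩ hl
      have := h3 _ hl
      simp only [Equiv.trans_apply] at this ⊢
      by_cases hip : i = p
      · subst hip
        have hb : b = true := by simpa [h2] using this
        subst hb
        simp only [Equiv.swap_apply_left, hh, Option.some_inj]
        refine ⟨fun hj => ?_, fun hj => by simp at hj⟩
        exact absurd (hj ▸ hl) hno.1
      · by_cases hiq : i = q
        · subst hiq
          simp only [Equiv.swap_apply_right, h2]
          refine ⟨fun hj => by simp at hj, fun hb => ?_⟩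
          subst hb
          have hj : h = j := by simpa [hh] using this
          exact absurd ⟨i, hip, hj ▸ hl⟩ hno.2
        · rwa [Equiv.swap_apply_of_ne_of_ne hip hiq]
  have : Nonempty (Fin (n + 1) ≃ Option (Fin n)) := ⟨finSuccEquiv n⟩
  choose! β hβ using key
  refine Finset.card_le_card_of_surjOn (fun e => (e.1, (β e.1).symm (some e.2))) ?_
  rintro ⟨p, q⟩ hpq
  rw [Finset.mem_coe, Finset.mem_product] at hpq
  obtain ⟨h, hh, hmem⟩ := hβ p hpq.1 q hpq.2
  exact ⟨(p, h), hmem, by simp [← hh]⟩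

end Critical

/-! ## The refuter problem -/

section Refuter

open DecisionTree

variable {V : Type} {F : CNF V} {L : ℕ}

theorem computes_predClause (i : Fin L) (p : Pred F i) :
    Computes 1 fun x : ∀ i : Fin L, ResNode F i => predClause x i p := by
  cases p with
  | inl C => exact Computes.const _
  | inr j => exact (Computes.query (A := fun i : Fin L => ResNode F i) _).map Prod.fst

theorem computes_validNode [DecidableEq V] (i : Fin L) :
    Computes 3 fun x : ∀ i : Fin L, ResNode F i => ValidNode x i := by
  refine (Computes.query (A := fun i : Fin L => ResNode F i) i).bind (e := 2)
    (G := fun r x => (match r.2 with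
      | .inl (j, k, a) => ∃ D E : Clause V, predClause x i j = insert (a, true) D ∧
          predClause x i k = insert (a, false) E ∧ r.1 = D ∪ E
      | .inr j => ∃ D : Clause V, r.1 = predClause x i j ∪ D) ∧
      ((i : ℕ) + 1 = L → r.1 = ∅)) fun r => ?_
  rcases r with ⟨c, ⟨j, k, a⟩ | j⟩
  · exact (computes_predClause i j).map₂ (computes_predClause i k) fun c₁ c₂ =>
      (∃ D E : Clause V, c₁ = insert (a, true) D ∧ c₂ = insert (a, false) E ∧ c = D ∪ E) ∧
        ((i : ℕ) + 1 = L → c = ∅)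
  · exact ((computes_predClause i j).map fun c₁ =>
      (∃ D : Clause V, c = c₁ ∪ D) ∧ ((i : ℕ) + 1 = L → c = ∅)).mono (by norm_num)

/-- A predecessor as a node; axioms are replaced by the node itself. -/
def predNode (i : Fin L) : Pred F i → Fin L
  | .inl _ => i
  | .inr j => ⟨j, j.2.trans i.2⟩

open Classical in
/-- If node `i` is valid and its weight is more than two thirds of `m`, a predecessor whose weight
is more than a third of `m`; otherwise `i` itself. -/
noncomputable def heavyPred [DecidableEq V] (μ : Clause V → ℕ) (m : ℕ)
    (x : ∀ i : Fin L, ResNode F i) (i : Fin L) : Fin L :=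
  if 2 * m < 3 * μ (x i).1 ∧ ValidNode x i then
    match (x i).2 with
    | .inl (j, k, _) => if m < 3 * μ (predClause x i j) then predNode i j else predNode i k
    | .inr j => predNode i j
  else i

variable [DecidableEq V] {μ : Clause V → ℕ} {m : ℕ}

-- Three queries test validity, one rereads the node and one reads the first premise of a
-- resolution. The second premise need not be weighed.
open Classical in
theorem computes_heavyPred (i : Fin L) :
    Computes 5 fun x : ∀ i : Fin L, ResNode F i => heavyPred μ m x i := by
  let next : Prop → ResNode F i → (∀ i : Fin L, ResNode F i) → Fin L := fun v r x =>
    if 2 * m < 3 * μ r.1 ∧ v then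
      match r.2 with
      | .inl (j, k, _) => if m < 3 * μ (predClause x i j) then predNode i j else predNode i k
      | .inr j => predNode i j
    else i
  have h : ∀ v r, Computes 1 (next v r) := by
    rintro v ⟨c, ⟨j, k, a⟩ | j⟩ <;> by_cases hv : 2 * m < 3 * μ c ∧ v
    · simp only [next, if_pos hv]
      exact (computes_predClause i j).map fun c => if m < 3 * μ c then predNode i j else predNode i k
    · simp only [next, if_neg hv]
      exact Computes.const i
    · simp only [next, if_pos hv]
      exact Computes.const _
    · simp only [next, if_neg hv]
      exact Computes.const i
  exact (computes_validNode i).bind (e := 2) (G := fun v x => next v (x i) x) fun v =>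
    (Computes.query (A := fun i : Fin L => ResNode F i) i).bind (G := next v) (h v)

theorem heavyPred_le (x : ∀ i : Fin L, ResNode F i) (i : Fin L) :
    heavyPred μ m x i ≤ i := by
  have h : ∀ p : Pred F i, predNode i p ≤ i := by
    rintro (C | j)
    · exact le_rfl
    · exact Fin.le_iff_val_le_val.2 j.2.le
  unfold heavyPred
  split
  · split
    · split <;> exact h _
    · exact h _
  · exact le_rfl

/-- If the first premise weighs at most m/3, subadditivity leaves more than 2m/3 − m/3 for the
second. The chosen premise is not an axiom, as axioms weigh at most m/3. -/
theorem heavyPred_spec (hanti : ∀ C₁ C₂, C₁ ⊆ C₂ → μ C₂ ≤ μ C₁)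
    (hres : ∀ C₁ C₂ a, μ (C₁ ∪ C₂) ≤ μ (insert (a, true) C₁) + μ (insert (a, false) C₂))
    (hax : ∀ C ∈ F, 3 * μ C ≤ m) {x : ∀ i : Fin L, ResNode F i} {i : Fin L}
    (hi : 2 * m < 3 * μ (x i).1) (hv : ValidNode x i) :
    heavyPred μ m x i < i ∧ m < 3 * μ (x (heavyPred μ m x i)).1 := by
  have h : ∀ p : Pred F i, m < 3 * μ (predClause x i p) →
      predNode i p < i ∧ m < 3 * μ (x (predNode i p)).1 := by
    rintro (C | j) hp
    · exact absurd hp (hax C.1 C.2).not_gt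
    · exact ⟨Fin.lt_def.2 j.2, hp⟩
  have hv' := hv.1
  rcases heq : (x i).2 with ⟨j, k, a⟩ | j
  · rw [heq] at hv'
    obtain ⟨D, E, hD, hE, hDE⟩ := hv'
    by_cases hj : m < 3 * μ (predClause x i j)
    · have hnext : heavyPred μ m x i = predNode i j := by
        rw [heavyPred, if_pos ⟨hi, hv⟩, heq]
        exact if_pos hj
      exact hnext ▸ h j hj
    · have hnext : heavyPred μ m x i = predNode i k := by
        rw [heavyPred, if_pos ⟨hi, hv⟩, heq]
        exact if_neg hj
      have := hres D E a
      rw [← hD, ← hE, ← hDE] at this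
      exact hnext ▸ h k (by omega)
  · rw [heq] at hv'
    obtain ⟨D, hD⟩ := hv'
    have hnext : heavyPred μ m x i = predNode i j := by
      rw [heavyPred, if_pos ⟨hi, hv⟩, heq]
    have := hanti _ _ (show predClause x i j ⊆ (x i).1 from hD ▸ Finset.subset_union_left)
    exact hnext ▸ h j (by omega)

end Refuter

/-- Elements with a rare property have short descriptions. -/
theorem exists_encoding {α : Type} [Fintype α] [Nonempty α] {B : ℕ} (hB : 0 < B) (s : Finset α)
    (hs : s.card ≤ B) : ∃ (enc : α → Fin B) (dec : Fin B → α), ∀ a ∈ s, dec (enc a) = a := by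
  classical
  obtain ⟨e⟩ : Nonempty (s ↪ Fin B) := Function.Embedding.nonempty_of_card_le (by simpa using hs)
  let enc : α → Fin B := fun a => if h : a ∈ s then e ⟨a, h⟩ else ⟨0, hB⟩
  refine ⟨enc, Function.invFunOn enc s, fun a ha => ?_⟩
  refine Set.InjOn.leftInvOn_invFunOn (fun a ha b hb hab => ?_) ha
  have ha' : a ∈ s := ha
  have hb' : b ∈ s := hb
  simp only [enc, dif_pos ha', dif_pos hb'] at hab
  simpa using e.injective hab

-- Here f decodes a pair (node, code) to a word, `I_v` walks down the heavy premises for the word v,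
-- and `g_v` returns the node reached together with the code of v relative to the clause there. The
-- number `B` of codes per node is `N / (2 * L)`, so that `M = L * B` is at most half of `N`.
open DecisionTree in
open Classical in
theorem exists_reduction_refuter_php {n L k : ℕ} (hn : 3 ≤ n) (hL : 1 ≤ L) (hk : 4 * k ≤ n + 1)
    (h : 2 * L * 7 ^ k ≤ 8 ^ k) : ∃ q : RwParam, q.N = (n * (n + 1)) ^ k ∧ q.L = L ∧
      ∀ d, 6 ≤ d → (rwPHPIter.prob q).size ≤ 2 ^ d →
        Nonempty (Reduction (refuter (PHP (n + 1) n) L) (rwPHPIter.prob q) d) := by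
  set N := (n * (n + 1)) ^ k with hN
  set B := N / (2 * L) with hB
  have hcard : Fintype.card (Fin (n + 1) × Fin n) = n * (n + 1) := by simp [mul_comm]
  have hLN : 2 * L ≤ N := calc
    2 * L ≤ 2 * L * 7 ^ k := Nat.le_mul_of_pos_right _ (by positivity)
    _ ≤ 8 ^ k := h
    _ ≤ N := Nat.pow_le_pow_left (by nlinarith) k
  have hBpos : 0 < B := Nat.div_pos hLN (by omega)
  have hMN : 2 * (L * B) ≤ N := by
    rw [← mul_assoc]
    exact Nat.mul_div_le N (2 * L)
  let Word := Fin k → Fin (n + 1) × Fin n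
  have hne : Nonempty Word := ⟨fun _ => (0, ⟨0, by omega⟩)⟩
  let eW : Word ≃ Fin N := Fintype.equivFinOfCardEq (by simp [Word, hcard, hN])
  let σ : Word → Finset (Fin (n + 1) × Fin n) := greedyMatching k ∅
  have hbad : ∀ T, (Finset.univ.filter fun v : Word => Misses T (σ v)).card ≤ B := by
    intro T
    rw [hB, Nat.le_div_iff_mul_le (by omega)]
    have h1 := card_misses_le T k ∅
    rw [hcard, mul_pow, ← hN] at h1
    refine Nat.le_of_mul_le_mul_left (c := 8 ^ k) ?_ (by positivity)
    calc _ = 2 * L * (8 ^ k * (Finset.univ.filter fun v : Word => Misses T (σ v)).card) := by ring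
      _ ≤ 2 * L * (7 ^ k * N) := Nat.mul_le_mul_left _ h1
      _ = 2 * L * 7 ^ k * N := by ring
      _ ≤ 8 ^ k * N := Nat.mul_le_mul_right _ h
  -- Given the clause, `B` codes suffice for the words whose matching misses its monotone edges.
  choose enc dec hdec using fun C : Clause (Fin (n + 1) × Fin n) =>
    exists_encoding hBpos _ (hbad (monotoneEdges C))
  let μ : Word → Clause (Fin (n + 1) × Fin n) → ℕ := fun v C => (missingPigeons (σ v) C).card
  have hm : ∀ v, 3 * (n + 1) ≤ 4 * μ v ∅ := by
    intro v
    have h1 := le_card_missingPigeons_empty (greedyMatching_pairwise k ∅ v (by simp))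
    have h2 : (greedyMatching k ∅ v).card ≤ k := by simpa using card_greedyMatching_le k ∅ v
    simp only [μ, σ]
    omega
  have hmiss : ∀ v C, μ v ∅ < 3 * μ v C → 3 * μ v C ≤ 2 * μ v ∅ →
      Misses (monotoneEdges C) (σ v) := by
    intro v C h1 h2
    refine ⟨fun e he heC => ?_, ?_⟩
    · rw [show μ v C = 0 from Finset.card_eq_zero.2 (missingPigeons_eq_empty he heC)] at h1
      omega
    · have h3 := card_mul_le_card_liveEdges (σ := σ v) (C := C)
      have h4 := hm v
      change μ v C * (μ v ∅ - μ v C) ≤ _ at h3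
      rw [hcard]
      obtain ⟨t, ht⟩ : ∃ t, μ v ∅ = μ v C + t := Nat.exists_eq_add_of_le (by omega)
      rw [ht, Nat.add_sub_cancel_left] at h3
      rw [ht] at h1 h2 h4
      generalize μ v C = s at *
      -- The difference of the two sides is (2s − t)(2t − s), nonnegative as s lies between one and
      -- two thirds of s + t. With s + t ≥ 3(n+1)/4 this gives st ≥ (n+1)²/8.
      have h5 : 2 * (s + t) * (s + t) ≤ 9 * (s * t) := by nlinarith
      nlinarith
  let S : Word → (∀ i : Fin L, ResNode (PHP (n + 1) n) i) → Fin L → Fin L := fun v x i =>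
    heavyPred (μ v) (μ v ∅) x i
  have hS : ∀ v x i, 2 * μ v ∅ < 3 * μ v (x i).1 → ValidNode x i →
      S v x i < i ∧ μ v ∅ < 3 * μ v (x (S v x i)).1 := by
    intro v x i
    refine heavyPred_spec (fun C₁ C₂ h => Finset.card_le_card (missingPigeons_anti h))
      (fun C₁ C₂ a => ?_) fun C hC => ?_
    · exact (Finset.card_le_card missingPigeons_resolve).trans (Finset.card_union_le _ _)
    · have h1 : μ v C ≤ 1 := card_missingPigeons_axiom hC
      have h2 := hm v
      change 3 * μ v C ≤ μ v ∅
      omega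
  refine ⟨⟨L * B, N, L, Nat.mul_pos hL hBpos, hMN, hL⟩, rfl, rfl, fun d hd hsize => ?_⟩
  refine Reduction.nonempty_of_computes (fun (x : ∀ i : Fin L, ResNode (PHP (n + 1) n) i) => ?_)
    (fun o x => S (eW.symm o.1) x (Fin.rev o.2)) ?_
    (fun o => (computes_heavyPred _).mono (by omega)) hsize ?_
  -- `Fin.rev` makes the descending walk ascend, with the last node as the source 0 of `Iter`.
  · exact fun
      | .inl i => eW (dec (x (finProdFinEquiv.symm i).1).1 (finProdFinEquiv.symm i).2)
      | .inr (.inl (y, t)) => Fin.rev (S (eW.symm y) x (Fin.rev t))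
      | .inr (.inr (y, t)) => finProdFinEquiv (S (eW.symm y) x (Fin.rev t),
          enc (x (S (eW.symm y) x (Fin.rev t))).1 (eW.symm y))
  · rintro (i | ⟨y, t⟩ | ⟨y, t⟩)
    · exact ((Computes.query (A := fun i : Fin L => ResNode (PHP (n + 1) n) i) _).map
        fun r => eW (dec r.1 (finProdFinEquiv.symm i).2)).mono (by omega)
    · exact ((computes_heavyPred _).map Fin.rev).mono (by omega)
    · exact ((computes_heavyPred _).bind (e := 1)
        (G := fun j x => finProdFinEquiv (j, enc (x j).1 (eW.symm y))) fun j =>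
        (Computes.query (A := fun i : Fin L => ResNode (PHP (n + 1) n) i) _).map
          fun r => finProdFinEquiv (j, enc r.1 (eW.symm y))).mono hd
  · rintro x ⟨(y : Fin N), (t : Fin L)⟩ ⟨ht, hne⟩
    change ¬ ValidNode x (S (eW.symm y) x (Fin.rev t))
    change eW (dec (x (finProdFinEquiv.symm (finProdFinEquiv _)).1).1
      (finProdFinEquiv.symm (finProdFinEquiv _)).2) ≠ y at hne
    rw [Equiv.symm_apply_apply] at hne
    change ((t : ℕ) = 0 ∧ Fin.rev (S (eW.symm y) x (Fin.rev t)) = t) ∨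
      Fin.rev (S (eW.symm y) x (Fin.rev t)) < t ∨ (t < Fin.rev (S (eW.symm y) x (Fin.rev t)) ∧
        Fin.rev (S (eW.symm y) x (Fin.rev (Fin.rev (S (eW.symm y) x (Fin.rev t))))) =
          Fin.rev (S (eW.symm y) x (Fin.rev t))) at ht
    generalize hv : eW.symm y = v at *
    obtain rfl : y = eW v := by simp [← hv]
    obtain ⟨i, rfl⟩ : ∃ i, t = Fin.rev i := ⟨Fin.rev t, (Fin.rev_rev t).symm⟩
    rw [Fin.rev_rev] at hne ⊢
    simp only [Fin.rev_rev, Fin.rev_inj, Fin.rev_lt_rev] at ht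
    intro hval
    -- A valid last node is empty, hence heavy, and could not be fixed. A step against the walk
    -- never occurs. In the third case the walk moves from i to a fixed node: if that node is heavy,
    -- it must be invalid; otherwise its weight is medium and decoding succeeds.
    rcases ht with ⟨h0, hi⟩ | hlt | ⟨hlt, heq⟩
    · rw [hi] at hval
      have hlast : (i : ℕ) + 1 = L := by
        rw [Fin.val_rev] at h0
        omega
      have h1 := hS v x i (by rw [hval.2 hlast]; have := hm v; omega) hval
      exact h1.1.ne hi
    · exact absurd (heavyPred_le x i) (not_le.2 hlt)
    · have hbig : 2 * μ v ∅ < 3 * μ v (x i).1 ∧ ValidNode x i := by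
        by_contra hno
        exact hlt.ne (if_neg hno)
      have h1 := hS v x i hbig.1 hbig.2
      by_cases h2 : 2 * μ v ∅ < 3 * μ v (x (S v x i)).1
      · exact (hS v x _ h2 hval).1.ne heq
      · refine hne (congrArg eW (hdec _ v ?_))
        simpa using hmiss v _ h1.2 (by omega)

/-! ## Refuter instances from ranked derivations -/

section Ranked

open DecisionTree

theorem exists_equiv_fin_of_rank {W : Type} [Fintype W] {T : ℕ} (hT : Fintype.card W = T)
    (r : W → ℕ) : ∃ e : W ≃ Fin T, ∀ w w', r w < r w' → e w < e w' := by
  let e₀ := Fintype.equivFinOfCardEq hT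
  obtain ⟨τ, hτ⟩ : ∃ τ : Equiv.Perm (Fin T), Monotone ((r ∘ e₀.symm) ∘ τ) :=
    ⟨_, Tuple.monotone_sort _⟩
  refine ⟨e₀.trans τ.symm, fun w w' h => ?_⟩
  by_contra hle
  have := hτ (not_lt.1 hle)
  simp only [Function.comp_apply, Equiv.trans_apply, Equiv.apply_symm_apply,
    Equiv.symm_apply_apply] at this
  omega

variable {V W : Type} {F : CNF V}

/-- Premises of a derivation from `F` whose lines are indexed by `W`. -/
abbrev Premise (F : CNF V) (W : Type) : Type := {C : Clause V // C ∈ F} ⊕ W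

/-- An inference: resolution with the resolved variable, or weakening. -/
abbrev Inference (F : CNF V) (W : Type) : Type :=
  (Premise F W × Premise F W × V) ⊕ Premise F W

/-- The clause of a premise, given the clauses of the lines. -/
def Premise.clause (c : W → Clause V) : Premise F W → Clause V
  | .inl C => C.1
  | .inr w => c w

/-- The premise is an axiom or a line of smaller rank. -/
def Premise.Below (r : W → ℕ) (w : W) : Premise F W → Prop
  | .inl _ => True
  | .inr w' => r w' < r w

/-- The line `w` with clauses `c` follows by the given inference from lines of smaller rank. -/
def SoundLine [DecidableEq V] (r : W → ℕ) (c : W → Clause V) (w : W) : Inference F W → Prop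
  | .inl (p, q, a) => p.Below r w ∧ q.Below r w ∧ ∃ D E : Clause V,
      p.clause c = insert (a, true) D ∧ q.clause c = insert (a, false) E ∧ c w = D ∪ E
  | .inr p => p.Below r w ∧ p.clause c ⊆ c w

/-- The premise as a predecessor of node `i`; a line that is not earlier is replaced by the axiom
`A`. -/
def Premise.toPred {T : ℕ} (A : {C : Clause V // C ∈ F}) (e : W → Fin T) (i : Fin T) :
    Premise F W → Pred F i
  | .inl C => .inl C
  | .inr w => if h : e w < i then .inr ⟨e w, h⟩ else .inl A

/-- The inference as the second component of node `i`. -/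
def Inference.toNode {T : ℕ} (A : {C : Clause V // C ∈ F}) (e : W → Fin T) (i : Fin T) :
    Inference F W → (Pred F i × Pred F i × V) ⊕ Pred F i
  | .inl (p, q, a) => .inl (p.toPred A e i, q.toPred A e i, a)
  | .inr p => .inr (p.toPred A e i)

variable [Fintype V] [DecidableEq V] [Fintype W]

/-- Sorting the lines by rank puts premises first. The last node has maximal rank, so its clause is
empty by `hroot`. The depth doubles because clause and inference are computed one after the other.
-/
theorem Reduction.nonempty_refuter_of_lines {P : SearchProblem} {T d : ℕ}
    (hT : Fintype.card W = T) (A : {C : Clause V // C ∈ F}) (r : W → ℕ)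
    (c : (∀ b, P.Alphabet b) → W → Clause V) (inf : (∀ b, P.Alphabet b) → W → Inference F W)
    (out : W → P.Sol) (hc : ∀ w, Computes d fun x => c x w)
    (hinf : ∀ w, Computes d fun x => inf x w)
    (hroot : ∀ x w, (∀ w', r w' ≤ r w) → c x w = ∅)
    (hsound : ∀ x w, ¬ P.rel x (out w) → SoundLine r (c x) w (inf x w))
    (hsize : (refuter F T).size ≤ 2 ^ (d + d)) :
    Nonempty (Reduction P (refuter F T) (d + d)) := by
  obtain ⟨e, he⟩ := exists_equiv_fin_of_rank hT r
  refine nonempty_of_computes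
    (fun x (i : Fin T) => ((c x (e.symm i), (inf x (e.symm i)).toNode A e i) : ResNode F i))
    (fun (i : Fin T) _ => out (e.symm i)) (fun (i : Fin T) => ?_) (fun _ => Computes.const _)
    hsize ?_
  · exact (hc (e.symm i)).map₂ (hinf (e.symm i)) fun C ι => ((C, ι.toNode A e i) : ResNode F i)
  · rintro x (i : Fin T) hi
    by_contra hrel
    refine hi ?_
    obtain ⟨w, rfl⟩ := e.surjective i
    have hs := hsound x w (by simpa using hrel)
    have hpred : ∀ p : Premise F W, p.Below r w →
        predClause (fun i : Fin T => ((c x (e.symm i), (inf x (e.symm i)).toNode A e i) :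
          ResNode F i)) (e w) (p.toPred A e (e w)) = p.clause (c x) := by
      rintro (C | w') hp
      · rfl
      · have h : e w' < e w := he _ _ hp
        rw [Premise.toPred, dif_pos h]
        change c x (e.symm (e w')) = c x w'
        rw [Equiv.symm_apply_apply]
    refine ⟨?_, fun hlast => ?_⟩
    · simp only [Equiv.symm_apply_apply]
      rcases hr : inf x w with ⟨p, q, a⟩ | p
      · rw [hr] at hs
        obtain ⟨hp, hq, D, E, hD, hE, hDE⟩ := hs
        exact ⟨D, E, (hpred p hp).trans hD, (hpred q hq).trans hE, hDE⟩
      · rw [hr] at hs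
        refine ⟨c x w, ?_⟩
        rw [hpred p hs.1, Finset.union_eq_right.2 hs.2]
    · simp only [Equiv.symm_apply_apply]
      refine hroot x w fun w' => ?_
      by_contra hlt
      have := Fin.lt_def.1 (he w w' (by omega))
      omega

end Ranked

/-! ## Hardness of refuters -/

section Hardness

open DecisionTree

/-- The clause reached after following `f` back through `t` layers; layer `t` decides the variable
`var t`. -/
def layerClause {V X : Type} [DecidableEq V] (var : ℕ → V) (f : X → X × Bool) : ℕ → X → Clause V
  | 0, _ => ∅
  | t + 1, v => insert (var t, (f v).2) (layerClause var f t (f v).1)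

theorem exists_mem_layerClause {V X : Type} [DecidableEq V] (var : ℕ → V) (f : X → X × Bool)
    {s t : ℕ} (hst : s < t) (v : X) : ∃ b, (var s, b) ∈ layerClause var f t v := by
  induction t generalizing v with
  | zero => omega
  | succ t ih =>
    rcases Nat.lt_succ_iff_lt_or_eq.1 hst with h | rfl
    · obtain ⟨b, hb⟩ := ih h (f v).1
      exact ⟨b, Finset.mem_insert_of_mem hb⟩
    · exact ⟨_, Finset.mem_insert_self ..⟩

theorem computes_layerClause {B : Type} {A : B → Type} {V X : Type} [DecidableEq V]
    (var : ℕ → V) {f : (∀ b, A b) → X → X × Bool} (hf : ∀ v, Computes 1 fun x => f x v)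
    (t : ℕ) (v : X) : Computes t fun x => layerClause var (f x) t v := by
  induction t generalizing v with
  | zero => exact Computes.const _
  | succ t ih =>
    exact ((hf v).bind (G := fun y x => insert (var t, y.2) (layerClause var (f x) t y.1))
      fun y => (ih y.1).map _).mono (by omega)

/-- `a` solves the `Iter` instance `S`. -/
abbrev IterSol {L : ℕ} (S : Fin L → Fin L) (a : Fin L) : Prop := (iterProblem L).rel S a

theorem computes_iterSol {B : Type} {A : B → Type} {L : ℕ} {S : (∀ b, A b) → Fin L → Fin L}
    (hS : ∀ a, Computes 1 fun x => S x a) (a : Fin L) : Computes 2 fun x => IterSol (S x) a :=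
  (hS a).bind (G := fun b x => ((a : ℕ) = 0 ∧ b = a) ∨ b < a ∨ (a < b ∧ S x b = b))
    fun b => (hS b).map fun b' => ((a : ℕ) = 0 ∧ b = a) ∨ b < a ∨ (a < b ∧ b' = b)

open Classical in
/-- Refuting a CNF is hard for `rwPHP(PLS)` as soon as the length admits the full decision tree
whose layers are collapsed to `M` nodes. -/
theorem exists_reduction_to_refuter {V : Type} [Fintype V] [DecidableEq V] {F : CNF V} {T d : ℕ}
    (hF : ∀ C : Clause V, (∀ a, ∃ b, (a, b) ∈ C) → ∃ A ∈ F, A ⊆ C) (q : RwParam)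
    (hV : 0 < Fintype.card V)
    (hT : (Fintype.card V + 1) * q.M + Fintype.card V * (q.M * 2 * q.L) ≤ T)
    (hd : Fintype.card V + 3 ≤ d) (hsize : (refuter F T).size ≤ 2 ^ (d + d)) :
    Nonempty (Reduction (rwPHPIter.prob q) (refuter F T) (d + d)) := by
  obtain ⟨M, N, L, hM, hMN, hL⟩ := q
  simp only at hT
  set n := Fintype.card V with hn
  obtain ⟨var, hvar⟩ : ∃ var : ℕ → V, ∀ a, ∃ t < n, var t = a := by
    let e := Fintype.equivFin V
    exact ⟨fun t => e.symm ⟨t % n, Nat.mod_lt _ hV⟩, fun a => ⟨e a, (e a).2,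
      e.symm_apply_eq.2 (Fin.ext (Nat.mod_eq_of_lt (e a).2))⟩⟩
  -- Since 2M ≤ N, the two outgoing edges of each of the M nodes of a layer fit into `[N]`.
  obtain ⟨ι, dec, hdec⟩ : ∃ (ι : Fin M × Bool → Fin N) (dec : Fin N → Fin M × Bool),
      ∀ y, dec (ι y) = y := by
    have : Nonempty (Fin M × Bool) := ⟨(⟨0, hM⟩, true)⟩
    obtain ⟨ι, dec, h⟩ := exists_encoding (B := N) (by omega)
      (Finset.univ : Finset (Fin M × Bool)) (by simpa [mul_comm] using hMN)
    exact ⟨ι, dec, fun y => h y (Finset.mem_univ y)⟩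
  have hax : ∀ C : Clause V, ∃ A : {C : Clause V // C ∈ F},
      (∀ a, ∃ b, (a, b) ∈ C) → A.1 ⊆ C := by
    intro C
    by_cases h : ∀ a, ∃ b, (a, b) ∈ C
    · obtain ⟨A, hA, hAC⟩ := hF C h
      exact ⟨⟨A, hA⟩, fun _ => hAC⟩
    · obtain ⟨A, hA, -⟩ := hF Finset.univ fun a => ⟨true, Finset.mem_univ _⟩
      exact ⟨⟨A, hA⟩, fun h' => absurd h' h⟩
  choose ax hax using hax
  let A := ax ∅
  let Input := ∀ b, RwAlphabet (iterProblem L) M N b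
  let f : Input → Fin M → Fin M × Bool := fun x v => dec (x (.inl v))
  let S : Input → Fin M × Bool → Fin L → Fin L := fun x y a => x (.inr (.inl (ι y, a)))
  let g : Input → Fin M × Bool → Fin L → Fin M := fun x y a => x (.inr (.inr (ι y, a)))
  have hf : ∀ v, Computes 1 fun x => f x v := fun v =>
    (Computes.query (A := RwAlphabet (iterProblem L) M N) (.inl v)).map dec
  have hS : ∀ y a, Computes 1 fun x => S x y a := fun y a =>
    Computes.query (A := RwAlphabet (iterProblem L) M N) (.inr (.inl (ι y, a)))
  have hg : ∀ y a, Computes 1 fun x => g x y a := fun y a =>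
    Computes.query (A := RwAlphabet (iterProblem L) M N) (.inr (.inr (ι y, a)))
  let z : Fin L := ⟨0, hL⟩
  -- The lines are the nodes of the layers, one chain for each edge between layers, and padding up
  -- to length `T`.
  let W := (Fin (n + 1) × Fin M) ⊕ (Fin n × (Fin M × Bool) × Fin L) ⊕
    Fin (T - ((n + 1) * M + n * (M * 2 * L)))
  have hW : Fintype.card W = T := by
    simp only [W, Fintype.card_sum, Fintype.card_prod, Fintype.card_fin, Fintype.card_bool]
    omega
  let main : Fin (n + 1) → Fin M → W := fun t v => .inl (t, v)
  let chain : Fin n → Fin M × Bool → Fin L → W := fun t y a => .inr (.inl (t, y, a))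
  -- Chain ranks exceed those of the next layer by `L - a`, between 1 and L, so they stay below the
  -- current layer.
  let r : W → ℕ
    | .inl (t, _) => (n - t) * (L + 2)
    | .inr (.inl (t, _, a)) => (n - t - 1) * (L + 2) + (L - a)
    | .inr (.inr _) => 0
  let edge : Input → ℕ → Fin M × Bool → Clause V := fun x t y =>
    insert (var t, y.2) (layerClause var (f x) t y.1)
  -- A nonzero fixed point of `S` need not be a solution and no chain is continued through it, so
  -- its line merely repeats an axiom.
  let c : Input → W → Clause V := fun x w => match w with
    | .inl (t, v) => layerClause var (f x) t v
    | .inr (.inl (t, y, a)) => if S x y a = a ∧ a ≠ z then A.1 else edge x t y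
    | .inr (.inr _) => A.1
  let inf : Input → W → Inference F W := fun x w => match w with
    | .inl (t, v) => if h : (t : ℕ) < n then
        .inl (.inr (chain ⟨t, h⟩ (v, true) z), .inr (chain ⟨t, h⟩ (v, false) z), var t)
      else .inr (.inl (ax (layerClause var (f x) t v)))
    | .inr (.inl (t, y, a)) =>
      if S x y a = a ∧ a ≠ z then .inr (.inl A)
      else if IterSol (S x y) a then .inr (.inr (main t.succ (g x y a)))
      else .inr (.inr (chain t y (S x y a)))
    | .inr (.inr _) => .inr (.inl A)
  -- Layer nodes and padding are always sound, so only the value on chain lines matters.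
  let out : W → Fin N × Fin L
    | .inl (_, v) => (ι (v, true), z)
    | .inr (.inl (_, y, a)) => (ι y, a)
    | .inr (.inr _) => (ι (⟨0, hM⟩, true), z)
  have hedge : ∀ t y, Computes t fun x => edge x t y := fun t y =>
    (computes_layerClause var hf t y.1).map _
  have hchain : ∀ x t y a, IterSol (S x y) a ∨ S x y a ≠ a → c x (chain t y a) = edge x t y := by
    intro x t y a h
    refine if_neg fun ⟨h1, h2⟩ => ?_
    rcases h with (⟨h, -⟩ | h | ⟨h, -⟩) | h
    · exact h2 (Fin.ext h)
    · exact h.ne h1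
    · exact h.ne' h1
    · exact h h1
  have hzero : ∀ x y, IterSol (S x y) z ∨ S x y z ≠ z := by
    intro x y
    by_cases h : S x y z = z
    · exact Or.inl (Or.inl ⟨rfl, h⟩)
    · exact Or.inr h
  have hrank : ∀ t : Fin n, ∃ s, n - t = s + 1 ∧ n - t - 1 = s :=
    fun t => ⟨n - t - 1, by omega, rfl⟩
  refine Reduction.nonempty_refuter_of_lines hW A r c inf out ?_ ?_ ?_ ?_ hsize
  · rintro (⟨t, v⟩ | ⟨t, y, a⟩ | i)
    · exact (computes_layerClause var hf t v).mono (by omega)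
    · exact ((hS y a).map₂ (hedge t y) fun b C => if b = a ∧ a ≠ z then A.1 else C).mono (by omega)
    · exact Computes.const _
  · rintro (⟨t, v⟩ | ⟨t, y, a⟩ | i)
    · by_cases h : (t : ℕ) < n
      · simp only [inf, dif_pos h]
        exact Computes.const _
      · simp only [inf, dif_neg h]
        exact ((computes_layerClause var hf t v).map fun C =>
          (.inr (.inl (ax C)) : Inference F W)).mono (by omega)
    · exact (((hS y a).map₂ ((computes_iterSol (hS y) a).map₂ (hg y a) Prod.mk)
        fun b p => (if b = a ∧ a ≠ z then .inr (.inl A)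
          else if p.1 then .inr (.inr (main t.succ p.2))
          else .inr (.inr (chain t y b)) : Inference F W))).mono (by omega)
    · exact Computes.const _
  · intro x w hw
    have h0 := hw (main 0 ⟨0, hM⟩)
    rcases w with ⟨t, v⟩ | ⟨t, y, a⟩ | i
    · simp only [r, main, Fin.val_zero, Nat.sub_zero] at h0
      have h1 := Nat.le_of_mul_le_mul_right h0 (by omega)
      have ht : (t : ℕ) = 0 := by omega
      change layerClause var (f x) t v = ∅
      rw [ht]
      rfl
    · simp only [r, main, Fin.val_zero, Nat.sub_zero] at h0
      obtain ⟨s, -, hs⟩ := hrank t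
      rw [hs] at h0
      have : (s + 1) * (L + 2) ≤ n * (L + 2) := Nat.mul_le_mul_right _ (by omega)
      rw [Nat.succ_mul] at this
      omega
    · simp only [r, main, Fin.val_zero, Nat.sub_zero] at h0
      have : 0 < n * (L + 2) := by positivity
      omega
  · rintro x (⟨t, v⟩ | ⟨t, y, a⟩ | i) hrel
    · by_cases h : (t : ℕ) < n
      · simp only [inf, dif_pos h]
        obtain ⟨s, hs, hs'⟩ := hrank ⟨t, h⟩
        simp only at hs hs'
        have hlt : (n - t - 1) * (L + 2) + (L - 0) < (n - t) * (L + 2) := by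
          rw [hs', hs, Nat.succ_mul]
          omega
        exact ⟨hlt, hlt, layerClause var (f x) t v, layerClause var (f x) t v,
          hchain x _ _ z (hzero x _), hchain x _ _ z (hzero x _), (Finset.union_self _).symm⟩
      · simp only [inf, dif_neg h]
        refine ⟨trivial, hax _ fun a => ?_⟩
        obtain ⟨u, hu, rfl⟩ := hvar a
        exact exists_mem_layerClause var (f x) (by omega) v
    · by_cases h1 : S x y a = a ∧ a ≠ z
      · simp only [inf, if_pos h1]
        refine ⟨trivial, ?_⟩
        change A.1 ⊆ if _ then _ else _
        rw [if_pos h1]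
      · have hc : c x (chain t y a) = edge x t y := if_neg h1
        obtain ⟨s, hs, hs'⟩ := hrank t
        by_cases h2 : IterSol (S x y) a
        · simp only [inf, if_neg h1, if_pos h2]
          refine ⟨?_, ?_⟩
          · change (n - t.succ) * (L + 2) < (n - t - 1) * (L + 2) + (L - a)
            rw [hs', Fin.val_succ, show n - (t + 1) = s by omega]
            omega
          · change layerClause var (f x) (t.succ : ℕ) (g x y a) ⊆ c x (chain t y a)
            rw [hc, Fin.val_succ]
            -- As `a` solves the `Iter` instance, this equation fails only if `(ι y, a)` solves the
            -- `rwPHP` instance.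
            have hfg : f x (g x y a) = y := by
              have : x (.inl (g x y a)) = ι y := by
                by_contra hne
                exact hrel ⟨h2, hne⟩
              change dec _ = y
              rw [this, hdec]
            simp only [layerClause, hfg]
            exact Finset.Subset.refl _
        · simp only [inf, if_neg h1, if_neg h2]
          have hlt : a < S x y a := by
            rcases lt_trichotomy (S x y a) a with h | h | h
            · exact (h2 (Or.inr (Or.inl h))).elim
            · rw [not_and_not_right] at h1
              exact (h2 (Or.inl ⟨congrArg Fin.val (h1 h), h⟩)).elim
            · exact h
          refine ⟨?_, ?_⟩
          · change (n - t - 1) * (L + 2) + (L - S x y a) < (n - t - 1) * (L + 2) + (L - a)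
            have := Fin.lt_def.1 hlt
            omega
          · change c x (chain t y (S x y a)) ⊆ c x (chain t y a)
            rw [hc, hchain x t y _ (Or.inr fun h => h2 (Or.inr (Or.inr ⟨hlt, h⟩)))]
    · exact ⟨trivial, Finset.Subset.refl _⟩

/-- If no pigeon has all its positive literals in `C`, every pigeon has a hole with the negative
literal in `C`, and two pigeons share such a hole. -/
theorem exists_axiom_subset_php (n : ℕ) (C : Clause (Fin (n + 1) × Fin n))
    (hC : ∀ a, ∃ b, (a, b) ∈ C) : ∃ A ∈ PHP (n + 1) n, A ⊆ C := by
  by_cases h : ∃ i, ∀ j, ((i, j), true) ∈ C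
  · obtain ⟨i, hi⟩ := h
    refine ⟨_, Finset.mem_union_left _ (Finset.mem_image_of_mem _ (Finset.mem_univ i)), ?_⟩
    rw [Finset.image_subset_iff]
    exact fun j _ => hi j
  · push Not at h
    choose φ hφ using h
    have hneg : ∀ i, ((i, φ i), false) ∈ C := by
      intro i
      obtain ⟨b, hb⟩ := hC (i, φ i)
      cases b with
      | true => exact absurd hb (hφ i)
      | false => exact hb
    obtain ⟨i, i', hne, heq⟩ := Fintype.exists_ne_map_eq_of_card_lt φ (by simp)
    wlog hlt : i < i' generalizing i i'
    · exact this i' i hne.symm heq.symm (lt_of_le_of_ne (not_lt.1 hlt) hne.symm)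
    refine ⟨_, Finset.mem_union_right _ (Finset.mem_image_of_mem _ (a := (i, i', φ i))
      (by simpa using hlt)), ?_⟩
    intro l hl
    simp only [Finset.mem_insert, Finset.mem_singleton] at hl
    rcases hl with rfl | rfl
    · exact hneg i
    · rw [heq]
      exact hneg i'

end Hardness

/-! ## Sizes -/

section Sizes

variable {V : Type} [Fintype V] [DecidableEq V]

theorem blockBits_refuter_le (F : CNF V) {L : ℕ} (hL : L ≤ 2 ^ (2 * Fintype.card V))
    (i : (refuter F L).Block) : (refuter F L).blockBits i ≤ 7 * Fintype.card V + 3 := by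
  obtain ⟨i, hi⟩ : Fin L := i
  refine Nat.clog_le_of_le_pow ?_
  change Fintype.card (ResNode F i) ≤ _
  set v := Fintype.card V with hv
  have hF : F.card ≤ 2 ^ (2 * v) := by
    refine (Finset.card_le_univ F).trans ?_
    simp [Fintype.card_finset, ← hv, mul_comm]
  have hcard : Fintype.card (ResNode F i) =
      2 ^ (2 * v) * ((F.card + i) * ((F.card + i) * v) + (F.card + i)) := by
    simp [Fintype.card_prod, Fintype.card_sum, Fintype.card_finset, ← hv, mul_comm]
  have hP : F.card + i ≤ 2 ^ (2 * v + 1) := by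
    rw [pow_succ]
    omega
  rw [hcard]
  calc 2 ^ (2 * v) * ((F.card + i) * ((F.card + i) * v) + (F.card + i))
      ≤ 2 ^ (2 * v) * (2 ^ (2 * v + 1) * (2 ^ (2 * v + 1) * 2 ^ v) +
        2 ^ (2 * v + 1) * (2 ^ (2 * v + 1) * 2 ^ v)) := by
        have h1 : v ≤ 2 ^ v := Nat.lt_two_pow_self.le
        have h2 : 1 ≤ 2 ^ (2 * v + 1) * 2 ^ v := Nat.one_le_iff_ne_zero.2 (by positivity)
        refine Nat.mul_le_mul_left _ (Nat.add_le_add ?_ ?_)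
        · gcongr
        · exact hP.trans (Nat.le_mul_of_pos_right _ h2)
    _ = 2 ^ (7 * v + 3) := by ring

theorem one_le_blockBits_refuter [Nonempty V] {F : CNF V} (hF : F.Nonempty) {L : ℕ}
    (i : (refuter F L).Block) : 1 ≤ (refuter F L).blockBits i := by
  obtain ⟨A, hA⟩ := hF
  refine Nat.clog_pos (by norm_num) (Fintype.one_lt_card_iff.2
    ⟨(∅, .inr (.inl ⟨A, hA⟩)), (Finset.univ, .inr (.inl ⟨A, hA⟩)), fun h => ?_⟩)
  exact Finset.univ_nonempty.ne_empty (congrArg Prod.fst h).symm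

theorem size_refuter_le (F : CNF V) {L : ℕ} (hL : L ≤ 2 ^ (2 * Fintype.card V)) :
    (refuter F L).size ≤ L * (7 * Fintype.card V + 3) := by
  refine (Finset.sum_le_card_nsmul _ _ _ fun i _ => blockBits_refuter_le F hL i).trans ?_
  change Fintype.card (Fin L) * _ ≤ _
  rw [Fintype.card_fin]

theorem le_size_refuter [Nonempty V] {F : CNF V} (hF : F.Nonempty) (L : ℕ) :
    L ≤ (refuter F L).size := by
  refine le_trans ?_ (Finset.card_nsmul_le_sum _ _ _ fun i _ => one_le_blockBits_refuter hF i)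
  change _ ≤ Fintype.card (Fin L) * _
  rw [Fintype.card_fin, mul_one]

theorem size_rwPHPIter (q : RwParam) : (rwPHPIter.prob q).size =
    q.M * Nat.clog 2 q.N + (q.N * q.L * Nat.clog 2 q.L + q.N * q.L * Nat.clog 2 q.M) := by
  obtain ⟨M, N, L, hM, hMN, hL⟩ := q
  have hsum : ∀ (φ : Fin M ⊕ (Fin N × Fin L) ⊕ (Fin N × Fin L) → ℕ) (a b c : ℕ),
      (∀ i, φ (.inl i) = a) → (∀ i, φ (.inr (.inl i)) = b) → (∀ i, φ (.inr (.inr i)) = c) →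
      ∑ i, φ i = M * a + (N * L * b + N * L * c) := by
    intro φ a b c h1 h2 h3
    simp [Fintype.sum_sum_type, h1, h2, h3]
  exact hsum _ _ _ _ (fun _ => congrArg (Nat.clog 2) (Fintype.card_fin N))
    (fun _ => congrArg (Nat.clog 2) (Fintype.card_fin L))
    fun _ => congrArg (Nat.clog 2) (Fintype.card_fin M)

theorem size_rwPHPIter_le {q : RwParam} {X : ℕ} (hN : q.N ≤ X) (hL : q.L ≤ X) :
    (rwPHPIter.prob q).size ≤ 3 * X ^ 3 := by
  have hM : q.M ≤ X := by have := q.two_mul_le; omega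
  have hX : 1 ≤ X := q.one_le_L.trans hL
  have hclog : ∀ t ≤ X, Nat.clog 2 t ≤ X := fun t ht =>
    (Nat.clog_le_of_le_pow Nat.lt_two_pow_self.le).trans ht
  rw [size_rwPHPIter]
  calc _ ≤ X * X + (X * X * X + X * X * X) := by gcongr <;> exact hclog _ (by assumption)
    _ ≤ 3 * X ^ 3 := by nlinarith [Nat.mul_le_mul_left (X * X) hX]

theorem le_size_rwPHPIter (q : RwParam) :
    q.M ≤ (rwPHPIter.prob q).size ∧ q.L ≤ (rwPHPIter.prob q).size := by
  have h1 := q.one_le_M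
  have h2 := q.two_mul_le
  have h3 : q.M ≤ q.M * Nat.clog 2 q.N :=
    Nat.le_mul_of_pos_right _ (Nat.clog_pos (by norm_num) (by omega))
  rw [size_rwPHPIter]
  refine ⟨by omega, ?_⟩
  rcases Nat.lt_or_ge q.L 2 with h | h
  · omega
  · have h4 : q.L ≤ q.N * q.L * Nat.clog 2 q.L := by
      rw [mul_right_comm]
      exact Nat.le_mul_of_pos_left _ (Nat.mul_pos (by omega) (Nat.clog_pos (by norm_num) h))
    omega

end Sizes

/-! ## The bound `1.01 ^ n` -/

theorem le_two_pow_of_le_rpow {n L : ℕ} (h : (L : ℝ) ≤ (1.01 : ℝ) ^ n) : L ≤ 2 ^ n := by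
  have : (L : ℝ) ≤ (2 : ℝ) ^ n := h.trans (pow_le_pow_left₀ (by norm_num) (by norm_num) n)
  exact_mod_cast this

/-- The constant 70 comes from 1.01^70 ≥ 2. -/
theorem two_pow_le_floor (m : ℕ) {n : ℕ} (h : 70 * m ≤ n) : 2 ^ m ≤ ⌊(1.01 : ℝ) ^ n⌋₊ := by
  refine Nat.le_floor ?_
  push_cast
  calc (2 : ℝ) ^ m ≤ ((1.01 : ℝ) ^ 70) ^ m := pow_le_pow_left₀ (by norm_num) (by norm_num) m
    _ = (1.01 : ℝ) ^ (70 * m) := (pow_mul ..).symm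
    _ ≤ (1.01 : ℝ) ^ n := pow_le_pow_right₀ (by norm_num) h

theorem two_mul_mul_seven_pow_le {n L : ℕ} (hn : 50 ≤ n) (h : (L : ℝ) ≤ (1.01 : ℝ) ^ n) :
    2 * L * 7 ^ ((n + 1) / 4) ≤ 8 ^ ((n + 1) / 4) := by
  -- Twelve factors 8/7 absorb 2·1.01^50, and each further one absorbs 1.01^4.
  obtain ⟨k, hk⟩ : ∃ k, (n + 1) / 4 = 12 + k := Nat.exists_eq_add_of_le (by omega)
  rw [hk]
  have h1 : (L : ℝ) ≤ 1.01 ^ 50 * (1.01 ^ 4) ^ k := by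
    rw [← pow_mul, ← pow_add]
    exact h.trans (pow_le_pow_right₀ (by norm_num) (by omega))
  have h2 : ((1.01 : ℝ) ^ 4) ^ k * 7 ^ k ≤ 8 ^ k := by
    rw [← mul_pow]
    exact pow_le_pow_left₀ (by norm_num) (by norm_num) k
  have h3 : 2 * (L : ℝ) * 7 ^ (12 + k) ≤ 8 ^ (12 + k) := calc
    2 * (L : ℝ) * 7 ^ (12 + k) ≤ 2 * (1.01 ^ 50 * (1.01 ^ 4) ^ k) * 7 ^ (12 + k) := by gcongr
    _ = (2 * 1.01 ^ 50 * 7 ^ 12) * ((1.01 ^ 4) ^ k * 7 ^ k) := by ring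
    _ ≤ 8 ^ 12 * 8 ^ k := mul_le_mul (by norm_num) h2 (by positivity) (by positivity)
    _ = 8 ^ (12 + k) := (pow_add ..).symm
  exact_mod_cast h3

/-! ## Reductions from the refuter -/

/-- A single node has only axioms as premises. Deriving the empty clause would need an empty axiom,
or a negative unit axiom for resolution, and `PHP` has neither. -/
theorem not_validNode_of_length_one {n : ℕ} (hn : 1 ≤ n)
    (x : ∀ i : Fin 1, ResNode (PHP (n + 1) n) i) (i : Fin 1) : ¬ ValidNode x i := by
  have hne : ∀ C ∈ PHP (n + 1) n, C ≠ ∅ ∧ ∀ a, C ≠ {(a, false)} := by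
    intro C hC
    simp only [PHP, Finset.mem_union, Finset.mem_image, Finset.mem_filter, Finset.mem_univ,
      true_and] at hC
    rcases hC with ⟨p, rfl⟩ | ⟨⟨p, p', j⟩, hlt, rfl⟩
    · have hmem : ((p, (⟨0, hn⟩ : Fin n)), true) ∈
          Finset.univ.image fun j : Fin n => ((p, j), true) :=
        Finset.mem_image_of_mem _ (Finset.mem_univ _)
      exact ⟨Finset.ne_empty_of_mem hmem, fun a h => by simp [h] at hmem⟩
    · refine ⟨Finset.insert_ne_empty _ _, fun a h => hlt.ne ?_⟩
      have h1 : ((p, j), false) = (a, false) :=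
        Finset.mem_singleton.1 (h ▸ Finset.mem_insert_self ..)
      have h2 : ((p', j), false) = (a, false) :=
        Finset.mem_singleton.1 (h ▸ Finset.mem_insert_of_mem (Finset.mem_singleton_self _))
      exact congrArg (fun l : Literal (Fin (n + 1) × Fin n) => l.1.1) (h1.trans h2.symm)
  have hax : ∀ p : Pred (PHP (n + 1) n) i, predClause x i p ∈ PHP (n + 1) n := by
    rintro (C | j)
    · exact C.2
    · have := j.2
      omega
  rintro ⟨hstep, hlast⟩
  have hempty := hlast (by omega)
  rcases heq : (x i).2 with ⟨j, k, a⟩ | j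
  · rw [heq] at hstep
    obtain ⟨D, E, -, hE, hDE⟩ := hstep
    rw [hempty, eq_comm, Finset.union_eq_empty] at hDE
    exact (hne _ (hax k)).2 a (by rw [hE, hDE.2]; rfl)
  · rw [heq] at hstep
    obtain ⟨D, hD⟩ := hstep
    rw [hempty, eq_comm, Finset.union_eq_empty] at hD
    exact (hne _ (hax j)).1 hD.1

open DecisionTree in
theorem exists_reduction_of_le_rpow {n L : ℕ} (hn : 1 ≤ n) (hL : 1 ≤ L)
    (h : (L : ℝ) ≤ (1.01 : ℝ) ^ n) :
    ∃ q, Nonempty (Reduction (refuter (PHP (n + 1) n) L) (rwPHPIter.prob q) (6 * n ^ 2 + 6)) := by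
  rcases Nat.lt_or_ge L 2 with hL2 | hL2
  · obtain rfl : L = 1 := by omega
    let q : RwParam := ⟨1, 2, 1, le_rfl, le_rfl, le_rfl⟩
    refine ⟨q, Reduction.nonempty_of_computes (fun _ => ?_) (fun _ _ => (0 : Fin 1)) (fun _ => ?_)
      (fun _ => Computes.const _) ?_ fun x _ _ => not_validNode_of_length_one hn x 0⟩
    · exact fun
        | .inl _ => (0 : Fin 2)
        | .inr (.inl _) => (0 : Fin 1)
        | .inr (.inr _) => (0 : Fin 1)
    · exact Computes.const _
    · refine (size_rwPHPIter_le (q := q) (X := 2) le_rfl (by norm_num [q])).trans ?_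
      calc 3 * 2 ^ 3 ≤ 2 ^ 6 := by norm_num
        _ ≤ _ := Nat.pow_le_pow_right (by norm_num) (by omega)
  -- Two nodes already force n to be large, so small n need no counting argument.
  · have hn50 : 50 ≤ n := by
      by_contra hlt
      have h1 : (L : ℝ) ≤ 1.01 ^ 49 := h.trans (pow_le_pow_right₀ (by norm_num) (by omega))
      have h2 : (2 : ℝ) ≤ L := by exact_mod_cast hL2
      norm_num at h1
      linarith
    obtain ⟨q, hqN, hqL, hq⟩ := exists_reduction_refuter_php (by omega) hL
      (show 4 * ((n + 1) / 4) ≤ n + 1 by omega) (two_mul_mul_seven_pow_le hn50 h)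
    refine ⟨q, hq _ (by omega) ?_⟩
    have hnn : n ≤ n ^ 2 := Nat.le_self_pow (by norm_num) n
    have hX1 : q.N ≤ 2 ^ (2 * n ^ 2) := by
      rw [hqN]
      calc (n * (n + 1)) ^ ((n + 1) / 4) ≤ (n * (n + 1)) ^ n :=
            Nat.pow_le_pow_right (by positivity) (by omega)
        _ ≤ (2 ^ n * 2 ^ n) ^ n := Nat.pow_le_pow_left
            (Nat.mul_le_mul Nat.lt_two_pow_self.le Nat.lt_two_pow_self) n
        _ = 2 ^ (2 * n ^ 2) := by rw [← pow_add, ← pow_mul]; congr 1; ring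
    have hX2 : q.L ≤ 2 ^ (2 * n ^ 2) := hqL ▸ (le_two_pow_of_le_rpow h).trans
      (Nat.pow_le_pow_right (by norm_num) (by omega))
    calc _ ≤ 3 * (2 ^ (2 * n ^ 2)) ^ 3 := size_rwPHPIter_le hX1 hX2
      _ ≤ 2 ^ 6 * (2 ^ (2 * n ^ 2)) ^ 3 := Nat.mul_le_mul_right _ (by norm_num)
      _ = 2 ^ (6 * n ^ 2 + 6) := by rw [← pow_mul, ← pow_add]; congr 1; ring

/-! ## Reductions to the refuter -/

theorem exists_reduction_to_hakenRefuter (q : RwParam) :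
    ∃ n : ℕ+, (n : ℕ) = 2800 * (Nat.log 2 (rwPHPIter.prob q).size + 1) ∧
      Nonempty (Reduction (rwPHPIter.prob q) (hakenRefuter.prob n) (32 * (n : ℕ) ^ 2 + 6)) := by
  obtain ⟨hM, hL⟩ := le_size_rwPHPIter q
  have hs := (Nat.lt_pow_succ_log_self (b := 2) (by norm_num) (rwPHPIter.prob q).size).le
  set m := Nat.log 2 (rwPHPIter.prob q).size + 1 with hm
  rw [Nat.succ_eq_add_one, ← hm] at hs
  replace hM := hM.trans hs
  replace hL := hL.trans hs
  have hm1 : 1 ≤ m := by omega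
  clear_value m
  -- 2800 = 70 · 40: the derivation has at most 2^(25 + 4m) ≤ 2^(40m) lines.
  obtain ⟨n, hn⟩ : ∃ n, n = 2800 * m := ⟨_, rfl⟩
  refine ⟨⟨n, by omega⟩, hn, ?_⟩
  change Nonempty (Reduction _ (refuter (PHP (n + 1) n) ⌊(1.01 : ℝ) ^ n⌋₊) (32 * n ^ 2 + 6))
  have hv : Fintype.card (Fin (n + 1) × Fin n) = n ^ 2 + n := by simp; ring
  have hnn : n ≤ n ^ 2 := Nat.le_self_pow (by norm_num) n
  have hT2 : ⌊(1.01 : ℝ) ^ n⌋₊ ≤ 2 ^ n := le_two_pow_of_le_rpow (Nat.floor_le (by positivity))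
  have key : Nonempty (Reduction (rwPHPIter.prob q) (refuter (PHP (n + 1) n) ⌊(1.01 : ℝ) ^ n⌋₊)
      ((8 * (n ^ 2 + n) + 3) + (8 * (n ^ 2 + n) + 3))) := by
    refine exists_reduction_to_refuter (exists_axiom_subset_php n) q (by rw [hv]; omega) ?_
      (by rw [hv]; omega) ?_
    · rw [hv]
      have hvm : n ^ 2 + n + 1 ≤ 2 ^ 23 * m ^ 2 := by rw [hn]; nlinarith
      have hmm : m ^ 2 ≤ 2 ^ (2 * m) := by
        rw [mul_comm, pow_mul]
        exact Nat.pow_le_pow_left Nat.lt_two_pow_self.le 2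
      calc (n ^ 2 + n + 1) * q.M + (n ^ 2 + n) * (q.M * 2 * q.L)
          ≤ (n ^ 2 + n + 1) * (2 ^ m * 2 ^ m) + (n ^ 2 + n + 1) * (2 ^ m * 2 * 2 ^ m) := by
            refine Nat.add_le_add (Nat.mul_le_mul_left _ ?_) (Nat.mul_le_mul (by omega) ?_)
            · exact hM.trans (Nat.le_mul_of_pos_right _ (by positivity))
            · gcongr
        _ = (n ^ 2 + n + 1) * (3 * 2 ^ (2 * m)) := by ring
        _ ≤ (2 ^ 23 * 2 ^ (2 * m)) * (4 * 2 ^ (2 * m)) :=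
            Nat.mul_le_mul (hvm.trans (Nat.mul_le_mul_left _ hmm))
              (Nat.mul_le_mul_right _ (by norm_num))
        _ = 2 ^ (25 + 4 * m) := by ring
        _ ≤ 2 ^ (40 * m) := Nat.pow_le_pow_right (by norm_num) (by omega)
        _ ≤ _ := two_pow_le_floor _ (by omega)
    · refine (size_refuter_le _ (hT2.trans ?_)).trans ?_
      · exact Nat.pow_le_pow_right (by norm_num) (by rw [hv]; omega)
      · rw [hv]
        calc _ ≤ 2 ^ n * 2 ^ (7 * (n ^ 2 + n) + 3) := Nat.mul_le_mul hT2 Nat.lt_two_pow_self.le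
          _ = 2 ^ (n + (7 * (n ^ 2 + n) + 3)) := (pow_add ..).symm
          _ ≤ _ := Nat.pow_le_pow_right (by norm_num) (by omega)
  exact Reduction.nonempty_mono key (by omega)

/-! ## Completeness -/

/-- An `Iter` instance without solution would have a < S a < S (S a) for the largest increasing
point a. Choosing a solution for each y, correct labels throughout would inject `[N]` into `[M]`. -/
theorem rwPHPIter_total (q : RwParam) (x : ∀ b, (rwPHPIter.prob q).Alphabet b) :
    ∃ o, (rwPHPIter.prob q).rel x o := by
  obtain ⟨M, N, L, hM, hMN, hL⟩ := q
  have hiter : ∀ S : Fin L → Fin L, ∃ a, IterSol S a := by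
    intro S
    by_contra! h
    have hinc : ∀ a, a < S a → S a < S (S a) := by
      intro a ha
      rcases lt_trichotomy (S (S a)) (S a) with h' | h' | h'
      · exact (h (S a) (Or.inr (Or.inl h'))).elim
      · exact (h a (Or.inr (Or.inr ⟨ha, h'⟩))).elim
      · exact h'
    have hz : (⟨0, hL⟩ : Fin L) < S ⟨0, hL⟩ := by
      refine lt_of_le_of_ne (Fin.le_def.2 (Nat.zero_le _)) fun h' => ?_
      exact h ⟨0, hL⟩ (Or.inl ⟨rfl, h'.symm⟩)
    obtain ⟨a, ha, hmax⟩ := (Finset.univ.filter fun a => a < S a).exists_max_image id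
      ⟨_, Finset.mem_filter.2 ⟨Finset.mem_univ _, hz⟩⟩
    have ha' := (Finset.mem_filter.1 ha).2
    exact (hmax (S a) (Finset.mem_filter.2 ⟨Finset.mem_univ _, hinc a ha'⟩)).not_gt ha'
  let f : Fin M → Fin N := fun i => x (.inl i)
  let S : Fin N → Fin L → Fin L := fun y a => x (.inr (.inl (y, a)))
  let g : Fin N → Fin L → Fin M := fun y a => x (.inr (.inr (y, a)))
  choose a ha using fun y => hiter (S y)
  by_contra! h
  have hinv : Function.LeftInverse f fun y => g y (a y) := fun y => by
    by_contra hne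
    exact h (y, a y) ⟨ha y, hne⟩
  have := Fintype.card_le_of_injective _ hinv.injective
  simp only [Fintype.card_fin] at this
  omega

theorem one_le_floor (n : ℕ) : 1 ≤ ⌊(1.01 : ℝ) ^ n⌋₊ := two_pow_le_floor 0 (by omega)

/-- At least 2^⌊n/70⌋ nodes carry one bit or more each; this turns bounds polynomial in n into
polylogarithmic ones. -/
theorem hakenRefuter_param_le (n : ℕ+) :
    (n : ℕ) ≤ 70 * Nat.log 2 (hakenRefuter.prob n).size + 69 := by
  have : NeZero (n : ℕ) := ⟨n.pos.ne'⟩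
  obtain ⟨A, hA, -⟩ := exists_axiom_subset_php n Finset.univ fun a => ⟨true, Finset.mem_univ _⟩
  have h1 := le_size_refuter ⟨A, hA⟩ ⌊(1.01 : ℝ) ^ (n : ℕ)⌋₊
  have h2 := Nat.le_log_of_pow_le (b := 2) (by norm_num)
    ((two_pow_le_floor ((n : ℕ) / 70) (by omega)).trans h1)
  change (n : ℕ) ≤ 70 * Nat.log 2 (refuter (PHP ((n : ℕ) + 1) n) ⌊(1.01 : ℝ) ^ (n : ℕ)⌋₊).size + 69
  omega

theorem exists_reduction_hakenRefuter (n : ℕ+) : ∃ q,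
    Nonempty (Reduction (hakenRefuter.prob n) (rwPHPIter.prob q) (6 * (n : ℕ) ^ 2 + 6)) :=
  exists_reduction_of_le_rpow n.pos (one_le_floor n) (Nat.floor_le (by positivity))

open DecisionTree in
open Classical in
theorem hakenRefuter_mem_TFNPdt : hakenRefuter ∈ TFNPdt := by
  refine ⟨?_, fun n => ?_⟩
  · obtain ⟨c, hc⟩ := PolyBounded.exists_le (g := fun l => 7 * ((70 * l + 69) * (70 * l + 69) +
        (70 * l + 69)) + 3)
      ((((PolyBounded.const 7).mul (((((PolyBounded.const 70).mul .id).add (.const 69)).mul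
        (((PolyBounded.const 70).mul .id).add (.const 69))).add
        (((PolyBounded.const 70).mul .id).add (.const 69)))).add (.const 3)))
    refine ⟨c, fun (n : ℕ+) => ?_⟩
    have hn := hakenRefuter_param_le n
    have hlog : ∀ t ≤ 7 * ((n : ℕ) * n + n) + 3, t ≤ polylog c (hakenRefuter.prob n).size :=
      fun t ht => (ht.trans (by gcongr)).trans (hc _)
    have hT : ⌊(1.01 : ℝ) ^ (n : ℕ)⌋₊ ≤ 2 ^ (n : ℕ) :=
      le_two_pow_of_le_rpow (Nat.floor_le (by positivity))
    have hv : Fintype.card (Fin ((n : ℕ) + 1) × Fin n) = (n : ℕ) * n + n := by simp; ring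
    refine ⟨fun b => hlog _ ?_, hlog _ ?_, fun o => ?_⟩
    · rw [← hv]
      refine blockBits_refuter_le _ (hT.trans (Nat.pow_le_pow_right (by norm_num) ?_)) b
      rw [hv]
      nlinarith
    · change Nat.clog 2 (Fintype.card (Fin ⌊(1.01 : ℝ) ^ (n : ℕ)⌋₊)) ≤ _
      rw [Fintype.card_fin]
      exact (Nat.clog_le_of_le_pow hT).trans (by nlinarith)
    · obtain ⟨T, hT, h⟩ := (computes_validNode (F := PHP ((n : ℕ) + 1) n)
        (L := ⌊(1.01 : ℝ) ^ (n : ℕ)⌋₊) o).map fun v => decide ¬ v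
      exact ⟨T, hT.mono (hlog 3 (by omega)), fun x =>
        (iff_of_eq (congrArg (· = true) (h x))).trans decide_eq_true_iff⟩
  -- Totality is Haken's lower bound itself, inherited from the target of the reduction.
  · obtain ⟨q, hq⟩ := exists_reduction_hakenRefuter n
    exact Reduction.total hq (rwPHPIter_total q)

theorem hakenRefuter_reduces : Reduces hakenRefuter rwPHPIter := by
  obtain ⟨c, hc⟩ := PolyBounded.exists_le (g := fun l => 6 * (70 * l + 69) ^ 2 + 6)
    (((PolyBounded.const 6).mul ((((PolyBounded.const 70).mul .id).add (.const 69)).pow 2)).add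
      (.const 6))
  refine ⟨c, fun n => ?_⟩
  obtain ⟨q, hq⟩ := exists_reduction_hakenRefuter n
  refine ⟨q, Reduction.nonempty_mono hq (le_trans ?_ (hc _))⟩
  have := hakenRefuter_param_le n
  gcongr

theorem reduces_hakenRefuter {P : ProblemFamily} (hP : Reduces P rwPHPIter) :
    Reduces P hakenRefuter := by
  obtain ⟨b, hb⟩ := hP
  -- If the first reduction has depth d, the intermediate length is at most 2^d, so n ≤ 2800(d + 1).
  let e : ℕ → ℕ := fun d => 32 * (2800 * (d + 1)) ^ 2 + 6
  have hpoly : PolyBounded fun l => b * l ^ b + b := .polylog b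
  have he : PolyBounded fun l => e (b * l ^ b + b) :=
    ((PolyBounded.const 32).mul (((PolyBounded.const 2800).mul (hpoly.add (.const 1))).pow 2)).add
      (.const 6)
  obtain ⟨c, hc⟩ := (((he.mul hpoly).add hpoly).add he).exists_le
  refine ⟨c, fun p => ?_⟩
  obtain ⟨q, hq⟩ := hb p
  obtain ⟨n, hn, hred⟩ := exists_reduction_to_hakenRefuter q
  have hle : Nat.log 2 (rwPHPIter.prob q).size ≤ polylog b (P.prob p).size := by
    obtain ⟨ρ⟩ := hq
    exact (Nat.log_mono_right ρ.size_le).trans (Nat.log_pow (by norm_num) _).le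
  have hred' := Reduction.nonempty_mono hred (e := e (polylog b (P.prob p).size)) (by
    simp only [e]
    rw [hn]
    gcongr)
  exact ⟨n, Reduction.nonempty_mono (Reduction.nonempty_comp hq hred') (hc _)⟩

theorem mainTheorem1 :
    IsCompleteFor hakenRefuter rwPHPPLS ∧
    ∃ c : ℕ,
      (∀ n L : ℕ, 1 ≤ n → 1 ≤ L → (L : ℝ) ≤ (1.01 : ℝ) ^ n → ∃ q : RwParam,
        Nonempty (Reduction (refuter (PHP (n + 1) n) L) (rwPHPIter.prob q) (c * n ^ c + c))) ∧
      (∀ q : RwParam, ∃ n : ℕ+, (n : ℕ) ≤ polylog c (rwPHPIter.prob q).size ∧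
        Nonempty (Reduction (rwPHPIter.prob q) (hakenRefuter.prob n)
          (c * (n : ℕ) ^ c + c))) := by
  -- 2800 dominates the constants 6 and 32 and the exponent 2; it stays opaque because it also
  -- occurs as an exponent.
  obtain ⟨c, hc⟩ : ∃ c, c = 2800 := ⟨_, rfl⟩
  refine ⟨⟨⟨hakenRefuter_mem_TFNPdt, hakenRefuter_reduces⟩, fun Q hQ => reduces_hakenRefuter hQ.2⟩,
    c, fun n L hn hL h => ?_, fun q => ?_⟩
  · obtain ⟨q, hq⟩ := exists_reduction_of_le_rpow hn hL h
    refine ⟨q, Reduction.nonempty_mono hq ?_⟩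
    gcongr <;> omega
  · obtain ⟨n, hn, hred⟩ := exists_reduction_to_hakenRefuter q
    refine ⟨n, ?_, Reduction.nonempty_mono hred ?_⟩
    · rw [hn, mul_add, mul_one, ← hc]
      unfold polylog
      gcongr
      exact Nat.le_self_pow (by omega) _
    · have := n.pos
      gcongr <;> omega
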